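/- Let $\mathbf k$ be a field of characteristic zero. All operads are nonsymmetric operads in $\mathbb Z$-graded (homological grading) $\mathbf k$-vector spaces, with the Koszul sign rule. Let $n\ge 2$ and $d\in\mathbb Z$, let $\mathcal X$ be a graded nonsymmetric collection concentrated in arity $n$ and homological degree $d$, and let $\mathcal R\subset\mathcal T(\mathcal X)^{(2)}$ be a (homogeneous) subcollection of the weight-two part of the free operad $\mathcal T(\mathcal X)$, where a tree tensor has weight $p$ if its tree has $p$ internal vertices. Let $\mathcal P=\mathcal P(\mathcal X,\mathcal R)=\mathcal T(\mathcal X)/(\mathcal R)$ be the corresponding quadratic operad, with the weight grading $\mathcal P^{(p)}$ given by the image of $\mathcal T(\mathcal X)^{(p)}$. Let $(\mathcal T(\mathcal E),\partial)\xrightarrow{\ \rho\ }(\mathcal P,0)$ be a minimal model of $\mathcal P$: $\mathcal E$ is a graded nonsymmetric collection with $\mathcal E(0)=\mathcal E(1)=0$, $\partial$ is a derivation of degree $-1$ with $\partial^2=0$ and $\partial(\mathcal E)\subset\bigoplus_{p\ge 2}\mathcal T(\mathcal E)^{(p)}$ (here the superscript counts internal vertices), and $\rho$ is a quasi-isomorphism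 of differential graded operads. By a weight grading of the minimal model we mean a decomposition $\mathcal E=\bigoplus_{p\ge 0}\mathcal E^{(p)}$ into (graded) subcollections such that, for the induced weight grading on $\mathcal T(\mathcal E)$ (the weight of a tree tensor is the sum of the weights of its vertices), both $\partial$ and $\rho$ preserve weights. Then the minimal model has a weight grading, and for every weight grading of it the generators $\mathcal E^{(1)}$, $\mathcal E^{(2)}$ and $\mathcal E^{(3)}$ of weights $1$, $2$ and $3$ are concentrated in homological degrees $d$, $2d+1$ and $3d+2$, respectively. -/

import Mathlib

universe u v w w'

/-- A nonsymmetric operad in homologically `ℤ`-graded vector spaces over `k`, presented by its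
partial compositions. The space `obj m i` is the component of arity `m` and homological degree
`i`. The map `comp a` is the partial composition at the input number `a`, the inputs of an
operation of arity `m` being numbered `0, …, m - 1`. -/
structure NSOperad (k : Type v) [Field k] where
  obj : ℕ → ℤ → Type w
  [addCommGroup : ∀ m i, AddCommGroup (obj m i)]
  [module : ∀ m i, Module k (obj m i)]
  /-- the identity operation -/
  one : obj 1 0
  comp : ∀ {m n l : ℕ} {i j p : ℤ} (a : ℕ), a < m → m + n = l + 1 → i + j = p →
    (obj m i →ₗ[k] obj n j →ₗ[k] obj l p)
  one_comp : ∀ {n : ℕ} {j : ℤ} (h : 0 < 1) (hl : 1 + n = n + 1) (hp : 0 + j = j) (x : obj n j),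
    comp 0 h hl hp one x = x
  comp_one : ∀ {m : ℕ} {i : ℤ} (a : ℕ) (ha : a < m) (hl : m + 1 = m + 1) (hp : i + 0 = i)
    (x : obj m i), comp a ha hl hp x one = x
  /-- sequential composition axiom -/
  comp_seq : ∀ {m n r l l' t : ℕ} {i j q f f' g : ℤ} (a b : ℕ) (ha : a < m) (hb : b < n)
    (hab : a + b < l) (hl : m + n = l + 1) (hl' : n + r = l' + 1)
    (ht : l + r = t + 1) (ht' : m + l' = t + 1)
    (hf : i + j = f) (hf' : j + q = f') (hg : f + q = g) (hg' : i + f' = g)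
    (x : obj m i) (y : obj n j) (z : obj r q),
    comp (a + b) hab ht hg (comp a ha hl hf x y) z
      = comp a ha ht' hg' x (comp b hb hl' hf' y z)
  /-- parallel composition axiom, with its Koszul sign -/
  comp_par : ∀ {m n r l l' t : ℕ} {i j q f f' g : ℤ} (a c s : ℕ) (ha : a < m) (hc : c < m)
    (_ : a < c) (_ : s + 1 = c + n) (hs : s < l) (ha' : a < l')
    (hl : m + n = l + 1) (hl' : m + r = l' + 1)
    (ht : l + r = t + 1) (ht' : l' + n = t + 1)
    (hf : i + j = f) (hf' : i + q = f') (hg : f + q = g) (hg' : f' + j = g)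
    (x : obj m i) (y : obj n j) (z : obj r q),
    comp s hs ht hg (comp a ha hl hf x y) z
      = (-1 : k) ^ (j * q) • comp a ha' ht' hg' (comp c hc hl' hf' x z) y

attribute [instance] NSOperad.addCommGroup NSOperad.module

namespace NSOperad

section

variable {k : Type v} [Field k]

/-- Morphisms of graded nonsymmetric operads. -/
structure Hom (P : NSOperad.{v, w} k) (Q : NSOperad.{v, w'} k) where
  map : ∀ {m : ℕ} {i : ℤ}, P.obj m i →ₗ[k] Q.obj m i
  map_one : map P.one = Q.one
  map_comp : ∀ {m n l : ℕ} {i j p : ℤ} (a : ℕ) (ha : a < m) (hl : m + n = l + 1)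
    (hp : i + j = p) (x : P.obj m i) (y : P.obj n j),
    map (P.comp a ha hl hp x y) = Q.comp a ha hl hp (map x) (map y)

/-- A differential on a graded operad: a derivation of degree `-1` that squares to zero. -/
structure Differential (P : NSOperad.{v, w} k) where
  d : ∀ {m : ℕ} {i j : ℤ}, j + 1 = i → (P.obj m i →ₗ[k] P.obj m j)
  d_d : ∀ {m : ℕ} {i j l : ℤ} (h : j + 1 = i) (h' : l + 1 = j) (x : P.obj m i), d h' (d h x) = 0
  leibniz : ∀ {m n l : ℕ} {i i' j j' p p' : ℤ} (a : ℕ) (ha : a < m) (hl : m + n = l + 1)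
    (hp : i + j = p) (hi : i' + 1 = i) (hj : j' + 1 = j) (hp' : p' + 1 = p)
    (h₁ : i' + j = p') (h₂ : i + j' = p') (x : P.obj m i) (y : P.obj n j),
    d hp' (P.comp a ha hl hp x y)
      = P.comp a ha hl h₁ (d hi x) y + (-1 : k) ^ i • P.comp a ha hl h₂ x (d hj y)

/-- The zero differential. -/
def Differential.zero (P : NSOperad.{v, w} k) : P.Differential where
  d _ := 0
  d_d _ _ _ := rfl
  leibniz := by intros; simp

variable {P : NSOperad.{v, w} k} {Q : NSOperad.{v, w'} k}

/-- Cycles in arity `m` and degree `i`. -/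
def Differential.cycles (D : P.Differential) (m : ℕ) (i : ℤ) : Submodule k (P.obj m i) :=
  LinearMap.ker (D.d (sub_add_cancel i 1))

/-- Boundaries in arity `m` and degree `i`. -/
def Differential.boundaries (D : P.Differential) (m : ℕ) (i : ℤ) : Submodule k (P.obj m i) :=
  LinearMap.range (D.d (m := m) (rfl : i + 1 = i + 1))

/-- Homology in arity `m` and degree `i`: cycles modulo boundaries. -/
abbrev Differential.Homology (D : P.Differential) (m : ℕ) (i : ℤ) : Type w :=
  D.cycles m i ⧸ (D.boundaries m i).submoduleOf (D.cycles m i)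

/-- Morphisms of dg operads `(P, D) → (Q, D')`. -/
structure DGHom (D : P.Differential) (D' : Q.Differential) extends Hom P Q where
  comm : ∀ {m : ℕ} {i j : ℤ} (h : j + 1 = i) (x : P.obj m i), map (D.d h x) = D'.d h (map x)

/-- The action of a morphism of dg operads on cycles. -/
def DGHom.cyclesMap {D : P.Differential} {D' : Q.Differential} (f : DGHom D D')
    (m : ℕ) (i : ℤ) : D.cycles m i →ₗ[k] D'.cycles m i :=
  LinearMap.restrict f.map (fun x hx => by
    have hx' : D.d (sub_add_cancel i 1) x = 0 := hx
    change D'.d (sub_add_cancel i 1) (f.map x) = 0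
    rw [← f.comm, hx', map_zero])

/-- The action of a morphism of dg operads on homology. -/
def DGHom.homologyMap {D : P.Differential} {D' : Q.Differential} (f : DGHom D D')
    (m : ℕ) (i : ℤ) : D.Homology m i →ₗ[k] D'.Homology m i :=
  Submodule.mapQ _ _ (f.cyclesMap m i) (by
    rintro ⟨x, hx⟩ ⟨y, hy⟩
    exact ⟨f.map y, by rw [← f.comm, hy]; rfl⟩)

/-- Weak equivalences of dg operads. -/
def DGHom.IsQuasiIso {D : P.Differential} {D' : Q.Differential} (f : DGHom D D') : Prop :=
  ∀ (m : ℕ) (i : ℤ), Function.Bijective (f.homologyMap m i)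

/-- Operadic ideals: subcollections closed under partial composition with arbitrary operations
on either side. -/
structure IsIdeal (P : NSOperad.{v, w} k) (I : ∀ m i, Submodule k (P.obj m i)) : Prop where
  comp_left : ∀ {m n l : ℕ} {i j p : ℤ} (a : ℕ) (ha : a < m) (hl : m + n = l + 1)
    (hp : i + j = p) (x : P.obj m i) (y : P.obj n j), x ∈ I m i → P.comp a ha hl hp x y ∈ I l p
  comp_right : ∀ {m n l : ℕ} {i j p : ℤ} (a : ℕ) (ha : a < m) (hl : m + n = l + 1)
    (hp : i + j = p) (x : P.obj m i) (y : P.obj n j), y ∈ I n j → P.comp a ha hl hp x y ∈ I l p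

/-- The smallest operadic ideal containing a subcollection. -/
def idealSpan (P : NSOperad.{v, w} k) (R : ∀ m i, Submodule k (P.obj m i)) :
    ∀ m i, Submodule k (P.obj m i) :=
  fun m i => ⨅ (I : ∀ m i, Submodule k (P.obj m i)) (_ : P.IsIdeal I)
    (_ : ∀ m i, R m i ≤ I m i), I m i

theorem idealSpan_isIdeal (P : NSOperad.{v, w} k) (R : ∀ m i, Submodule k (P.obj m i)) :
    P.IsIdeal (P.idealSpan R) where
  comp_left a ha hl hp x y hx := by
    simp only [idealSpan, Submodule.mem_iInf] at hx ⊢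
    exact fun I hI hR => hI.comp_left a ha hl hp x y (hx I hI hR)
  comp_right a ha hl hp x y hy := by
    simp only [idealSpan, Submodule.mem_iInf] at hy ⊢
    exact fun I hI hR => hI.comp_right a ha hl hp x y (hy I hI hR)

/-- The partial compositions of a quotient operad. -/
def quotientComp (P : NSOperad.{v, w} k) (I : ∀ m i, Submodule k (P.obj m i)) (hI : P.IsIdeal I)
    {m n l : ℕ} {i j p : ℤ} (a : ℕ) (ha : a < m) (hl : m + n = l + 1) (hp : i + j = p) :
    (P.obj m i ⧸ I m i) →ₗ[k] (P.obj n j ⧸ I n j) →ₗ[k] (P.obj l p ⧸ I l p) :=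
  (I m i).liftQ
    ((I n j).liftQ ((P.comp a ha hl hp).compr₂ (I l p).mkQ).flip (by
      intro y hy
      ext x
      simpa using hI.comp_right a ha hl hp x y hy)).flip (by
    intro x hx
    ext y
    exact (Submodule.Quotient.mk_eq_zero _).2 (hI.comp_left a ha hl hp x y hx))

/-- The quotient of an operad by an operadic ideal. -/
def quotient (P : NSOperad.{v, w} k) (I : ∀ m i, Submodule k (P.obj m i)) (hI : P.IsIdeal I) :
    NSOperad.{v, w} k where
  obj m i := P.obj m i ⧸ I m i
  one := (I 1 0).mkQ P.one
  comp a ha hl hp := P.quotientComp I hI a ha hl hp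
  one_comp h hl hp x := by
    obtain ⟨x, rfl⟩ := Submodule.mkQ_surjective _ x
    exact congrArg (Submodule.mkQ _) (P.one_comp h hl hp x)
  comp_one a ha hl hp x := by
    obtain ⟨x, rfl⟩ := Submodule.mkQ_surjective _ x
    exact congrArg (Submodule.mkQ _) (P.comp_one a ha hl hp x)
  comp_seq a b ha hb hab hl hl' ht ht' hf hf' hg hg' x y z := by
    obtain ⟨x, rfl⟩ := Submodule.mkQ_surjective _ x
    obtain ⟨y, rfl⟩ := Submodule.mkQ_surjective _ y
    obtain ⟨z, rfl⟩ := Submodule.mkQ_surjective _ z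
    exact congrArg (Submodule.mkQ _)
      (P.comp_seq a b ha hb hab hl hl' ht ht' hf hf' hg hg' x y z)
  comp_par a c s ha hc hac hsc hs ha' hl hl' ht ht' hf hf' hg hg' x y z := by
    obtain ⟨x, rfl⟩ := Submodule.mkQ_surjective _ x
    obtain ⟨y, rfl⟩ := Submodule.mkQ_surjective _ y
    obtain ⟨z, rfl⟩ := Submodule.mkQ_surjective _ z
    exact congrArg (Submodule.mkQ _)
      (P.comp_par a c s ha hc hac hsc hs ha' hl hl' ht ht' hf hf' hg hg' x y z)

end

end NSOperad

/-! ### Free operads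

The free operad on a graded collection `E` is built from formal expressions in the elements of
`E`, the identity, linear combinations and partial compositions, modulo the linearity of
`E → T(E)`, the vector space axioms, the bilinearity of the partial compositions and the operad
axioms. Its universal property is `FreeOperad.lift`, `FreeOperad.lift_gen` and
`FreeOperad.hom_ext`. -/

namespace FreeOperad

section

variable (k : Type v) [Field k] (E : ℕ → ℤ → Type u)
  [∀ m i, AddCommGroup (E m i)] [∀ m i, Module k (E m i)]

/-- Formal operadic expressions. -/
inductive Pre (k : Type v) (E : ℕ → ℤ → Type u) : ℕ → ℤ → Type (max u v)
  | zero {m : ℕ} {i : ℤ} : Pre k E m i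
  | add {m : ℕ} {i : ℤ} : Pre k E m i → Pre k E m i → Pre k E m i
  | smul {m : ℕ} {i : ℤ} : k → Pre k E m i → Pre k E m i
  | one : Pre k E 1 0
  | gen {m : ℕ} {i : ℤ} : E m i → Pre k E m i
  | comp {m n l : ℕ} {i j p : ℤ} (a : ℕ) (ha : a < m) (hl : m + n = l + 1) (hp : i + j = p) :
      Pre k E m i → Pre k E n j → Pre k E l p

/-- The relations imposed on formal expressions. -/
inductive Rel : ∀ {m : ℕ} {i : ℤ}, Pre k E m i → Pre k E m i → Prop
  -- congruence
  | add_congr_left {m i} {x x' : Pre k E m i} (y : Pre k E m i) :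
      Rel x x' → Rel (x.add y) (x'.add y)
  | add_congr_right {m i} (x : Pre k E m i) {y y' : Pre k E m i} :
      Rel y y' → Rel (x.add y) (x.add y')
  | smul_congr {m i} (c : k) {x x' : Pre k E m i} : Rel x x' → Rel (x.smul c) (x'.smul c)
  | comp_congr_left {m n l : ℕ} {i j p : ℤ} (a : ℕ) (ha : a < m) (hl : m + n = l + 1)
      (hp : i + j = p) {x x' : Pre k E m i} (y : Pre k E n j) :
      Rel x x' → Rel (x.comp a ha hl hp y) (x'.comp a ha hl hp y)
  | comp_congr_right {m n l : ℕ} {i j p : ℤ} (a : ℕ) (ha : a < m) (hl : m + n = l + 1)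
      (hp : i + j = p) (x : Pre k E m i) {y y' : Pre k E n j} :
      Rel y y' → Rel (x.comp a ha hl hp y) (x.comp a ha hl hp y')
  -- vector space axioms
  | add_assoc {m i} (x y z : Pre k E m i) : Rel ((x.add y).add z) (x.add (y.add z))
  | add_comm {m i} (x y : Pre k E m i) : Rel (x.add y) (y.add x)
  | zero_add {m i} (x : Pre k E m i) : Rel (Pre.zero.add x) x
  | zero_smul {m i} (x : Pre k E m i) : Rel (x.smul 0) Pre.zero
  | one_smul {m i} (x : Pre k E m i) : Rel (x.smul 1) x
  | mul_smul {m i} (c c' : k) (x : Pre k E m i) : Rel (x.smul (c * c')) ((x.smul c').smul c)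
  | add_smul {m i} (c c' : k) (x : Pre k E m i) :
      Rel (x.smul (c + c')) ((x.smul c).add (x.smul c'))
  | smul_add {m i} (c : k) (x y : Pre k E m i) :
      Rel ((x.add y).smul c) ((x.smul c).add (y.smul c))
  -- linearity of the inclusion of generators
  | gen_add {m i} (e e' : E m i) : Rel (Pre.gen (e + e')) ((Pre.gen e).add (Pre.gen e'))
  | gen_smul {m i} (c : k) (e : E m i) : Rel (Pre.gen (c • e)) ((Pre.gen e).smul c)
  -- bilinearity of the partial compositions
  | comp_add_left {m n l : ℕ} {i j p : ℤ} (a : ℕ) (ha : a < m) (hl : m + n = l + 1)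
      (hp : i + j = p) (x x' : Pre k E m i) (y : Pre k E n j) :
      Rel ((x.add x').comp a ha hl hp y) ((x.comp a ha hl hp y).add (x'.comp a ha hl hp y))
  | comp_add_right {m n l : ℕ} {i j p : ℤ} (a : ℕ) (ha : a < m) (hl : m + n = l + 1)
      (hp : i + j = p) (x : Pre k E m i) (y y' : Pre k E n j) :
      Rel (x.comp a ha hl hp (y.add y')) ((x.comp a ha hl hp y).add (x.comp a ha hl hp y'))
  | comp_smul_left {m n l : ℕ} {i j p : ℤ} (a : ℕ) (ha : a < m) (hl : m + n = l + 1)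
      (hp : i + j = p) (c : k) (x : Pre k E m i) (y : Pre k E n j) :
      Rel ((x.smul c).comp a ha hl hp y) ((x.comp a ha hl hp y).smul c)
  | comp_smul_right {m n l : ℕ} {i j p : ℤ} (a : ℕ) (ha : a < m) (hl : m + n = l + 1)
      (hp : i + j = p) (c : k) (x : Pre k E m i) (y : Pre k E n j) :
      Rel (x.comp a ha hl hp (y.smul c)) ((x.comp a ha hl hp y).smul c)
  -- operad axioms
  | one_comp {n : ℕ} {j : ℤ} (h : 0 < 1) (hl : 1 + n = n + 1) (hp : 0 + j = j)
      (x : Pre k E n j) : Rel (Pre.one.comp 0 h hl hp x) x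
  | comp_one {m : ℕ} {i : ℤ} (a : ℕ) (ha : a < m) (hl : m + 1 = m + 1) (hp : i + 0 = i)
      (x : Pre k E m i) : Rel (x.comp a ha hl hp Pre.one) x
  | comp_seq {m n r l l' t : ℕ} {i j q f f' g : ℤ} (a b : ℕ) (ha : a < m) (hb : b < n)
      (hab : a + b < l) (hl : m + n = l + 1) (hl' : n + r = l' + 1)
      (ht : l + r = t + 1) (ht' : m + l' = t + 1)
      (hf : i + j = f) (hf' : j + q = f') (hg : f + q = g) (hg' : i + f' = g)
      (x : Pre k E m i) (y : Pre k E n j) (z : Pre k E r q) :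
      Rel ((x.comp a ha hl hf y).comp (a + b) hab ht hg z)
        (x.comp a ha ht' hg' (y.comp b hb hl' hf' z))
  | comp_par {m n r l l' t : ℕ} {i j q f f' g : ℤ} (a c s : ℕ) (ha : a < m) (hc : c < m)
      (hac : a < c) (hsc : s + 1 = c + n) (hs : s < l) (ha' : a < l')
      (hl : m + n = l + 1) (hl' : m + r = l' + 1)
      (ht : l + r = t + 1) (ht' : l' + n = t + 1)
      (hf : i + j = f) (hf' : i + q = f') (hg : f + q = g) (hg' : f' + j = g)
      (x : Pre k E m i) (y : Pre k E n j) (z : Pre k E r q) :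
      Rel ((x.comp a ha hl hf y).comp s hs ht hg z)
        (((x.comp c hc hl' hf' z).comp a ha' ht' hg' y).smul ((-1 : k) ^ (j * q)))

/-- The component of arity `m` and degree `i` of the free operad on `E`. -/
def Obj (m : ℕ) (i : ℤ) : Type (max u v) := Quot (Rel k E (m := m) (i := i))

instance (m : ℕ) (i : ℤ) : Zero (Obj k E m i) where
  zero := Quot.mk _ Pre.zero

instance (m : ℕ) (i : ℤ) : Add (Obj k E m i) where
  add := Quot.map₂ Pre.add (fun x _ _ h => Rel.add_congr_right x h)
    (fun _ _ y h => Rel.add_congr_left y h)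

instance (m : ℕ) (i : ℤ) : AddCommMonoid (Obj k E m i) where
  add_assoc := by
    rintro ⟨x⟩ ⟨y⟩ ⟨z⟩
    exact Quot.sound (Rel.add_assoc x y z)
  add_comm := by
    rintro ⟨x⟩ ⟨y⟩
    exact Quot.sound (Rel.add_comm x y)
  zero_add := by
    rintro ⟨x⟩
    exact Quot.sound (Rel.zero_add x)
  add_zero := by
    rintro ⟨x⟩
    exact (Quot.sound (Rel.add_comm x Pre.zero)).trans (Quot.sound (Rel.zero_add x))
  nsmul := nsmulRec

instance (m : ℕ) (i : ℤ) : SMul k (Obj k E m i) where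
  smul c := Quot.map (Pre.smul c) (fun _ _ h => Rel.smul_congr c h)

instance (m : ℕ) (i : ℤ) : Module k (Obj k E m i) where
  one_smul := by
    rintro ⟨x⟩
    exact Quot.sound (Rel.one_smul x)
  mul_smul := by
    rintro c c' ⟨x⟩
    exact Quot.sound (Rel.mul_smul c c' x)
  smul_zero c := by
    have h0 : (0 : Obj k E m i) = (0 : k) • (0 : Obj k E m i) :=
      (Quot.sound (Rel.zero_smul (k := k) (E := E) Pre.zero)).symm
    have h1 : (c • ((0 : k) • (0 : Obj k E m i))) = (c * 0) • (0 : Obj k E m i) :=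
      (Quot.sound (Rel.mul_smul (k := k) (E := E) c 0 Pre.zero)).symm
    rw [mul_zero, ← h0] at h1
    exact h1
  smul_add := by
    rintro c ⟨x⟩ ⟨y⟩
    exact Quot.sound (Rel.smul_add c x y)
  add_smul := by
    rintro c c' ⟨x⟩
    exact Quot.sound (Rel.add_smul c c' x)
  zero_smul := by
    rintro ⟨x⟩
    exact Quot.sound (Rel.zero_smul x)

instance (m : ℕ) (i : ℤ) : AddCommGroup (Obj k E m i) :=
  Module.addCommMonoidToAddCommGroup k

/-- The partial compositions of the free operad. -/
def compObj {m n l : ℕ} {i j p : ℤ} (a : ℕ) (ha : a < m) (hl : m + n = l + 1) (hp : i + j = p) :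
    Obj k E m i →ₗ[k] Obj k E n j →ₗ[k] Obj k E l p :=
  LinearMap.mk₂ k
    (Quot.map₂ (Pre.comp a ha hl hp) (fun x _ _ h => Rel.comp_congr_right a ha hl hp x h)
      (fun _ _ y h => Rel.comp_congr_left a ha hl hp y h))
    (by
      rintro ⟨x⟩ ⟨x'⟩ ⟨y⟩
      exact Quot.sound (Rel.comp_add_left a ha hl hp x x' y))
    (by
      rintro c ⟨x⟩ ⟨y⟩
      exact Quot.sound (Rel.comp_smul_left a ha hl hp c x y))
    (by
      rintro ⟨x⟩ ⟨y⟩ ⟨y'⟩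
      exact Quot.sound (Rel.comp_add_right a ha hl hp x y y'))
    (by
      rintro c ⟨x⟩ ⟨y⟩
      exact Quot.sound (Rel.comp_smul_right a ha hl hp c x y))

end

end FreeOperad

/-- The free operad `T(E)` on a graded nonsymmetric collection `E`. -/
def freeOperad (k : Type v) [Field k] (E : ℕ → ℤ → Type u)
    [∀ m i, AddCommGroup (E m i)] [∀ m i, Module k (E m i)] : NSOperad.{v, max u v} k where
  obj := FreeOperad.Obj k E
  one := Quot.mk _ FreeOperad.Pre.one
  comp a ha hl hp := FreeOperad.compObj k E a ha hl hp
  one_comp := by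
    rintro n j h hl hp ⟨x⟩
    exact Quot.sound (FreeOperad.Rel.one_comp h hl hp x)
  comp_one := by
    rintro m i a ha hl hp ⟨x⟩
    exact Quot.sound (FreeOperad.Rel.comp_one a ha hl hp x)
  comp_seq := by
    rintro m n r l l' t i j q f f' g a b ha hb hab hl hl' ht ht' hf hf' hg hg' ⟨x⟩ ⟨y⟩ ⟨z⟩
    exact Quot.sound
      (FreeOperad.Rel.comp_seq a b ha hb hab hl hl' ht ht' hf hf' hg hg' x y z)
  comp_par := by
    rintro m n r l l' t i j q f f' g a c s ha hc hac hsc hs ha' hl hl' ht ht' hf hf' hg hg'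
      ⟨x⟩ ⟨y⟩ ⟨z⟩
    exact Quot.sound
      (FreeOperad.Rel.comp_par a c s ha hc hac hsc hs ha' hl hl' ht ht' hf hf' hg hg' x y z)

namespace FreeOperad

section

variable {k : Type v} [Field k] {E : ℕ → ℤ → Type u}
  [∀ m i, AddCommGroup (E m i)] [∀ m i, Module k (E m i)]

variable (k E) in
/-- The inclusion of the generators `E → T(E)`. -/
def gen {m : ℕ} {i : ℤ} : E m i →ₗ[k] (freeOperad k E).obj m i where
  toFun e := Quot.mk _ (Pre.gen e)
  map_add' e e' := Quot.sound (Rel.gen_add e e')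
  map_smul' c e := Quot.sound (Rel.gen_smul c e)

/-- Evaluation of formal expressions in an operad. -/
def Pre.eval (P : NSOperad.{v, w} k) (φ : ∀ {m i}, E m i →ₗ[k] P.obj m i) :
    ∀ {m : ℕ} {i : ℤ}, Pre k E m i → P.obj m i
  | _, _, .zero => 0
  | _, _, .add x y => x.eval P φ + y.eval P φ
  | _, _, .smul c x => c • x.eval P φ
  | _, _, .one => P.one
  | _, _, .gen e => φ e
  | _, _, .comp a ha hl hp x y => P.comp a ha hl hp (x.eval P φ) (y.eval P φ)

theorem Pre.eval_eq (P : NSOperad.{v, w} k) (φ : ∀ {m i}, E m i →ₗ[k] P.obj m i)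
    {m : ℕ} {i : ℤ} {x y : Pre k E m i} (h : Rel k E x y) : x.eval P φ = y.eval P φ := by
  induction h with
  | add_assoc => exact _root_.add_assoc _ _ _
  | add_comm => exact _root_.add_comm _ _
  | mul_smul => exact SemigroupAction.mul_smul _ _ _
  | add_smul => exact _root_.add_smul _ _ _
  | one_comp => exact P.one_comp _ _ _ _
  | comp_one => exact P.comp_one _ _ _ _ _
  | comp_seq => apply P.comp_seq
  | comp_par => apply P.comp_par <;> assumption
  | _ => simp_all [Pre.eval]

/-- The morphism `T(E) → P` extending a map of collections `E → P`. -/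
def lift (P : NSOperad.{v, w} k) (φ : ∀ {m i}, E m i →ₗ[k] P.obj m i) :
    (freeOperad k E).Hom P where
  map :=
    { toFun := Quot.lift (Pre.eval P φ) (fun _ _ h => Pre.eval_eq P φ h)
      map_add' := by
        rintro ⟨x⟩ ⟨y⟩
        rfl
      map_smul' := by
        rintro c ⟨x⟩
        rfl }
  map_one := rfl
  map_comp := by
    rintro m n l i j p a ha hl hp ⟨x⟩ ⟨y⟩
    rfl

theorem lift_gen (P : NSOperad.{v, w} k) (φ : ∀ {m i}, E m i →ₗ[k] P.obj m i)
    {m : ℕ} {i : ℤ} (e : E m i) : (lift P φ).map (gen k E e) = φ e := rfl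

theorem hom_ext {P : NSOperad.{v, w} k} {f g : (freeOperad k E).Hom P}
    (h : ∀ {m : ℕ} {i : ℤ} (e : E m i), f.map (gen k E e) = g.map (gen k E e))
    {m : ℕ} {i : ℤ} (t : (freeOperad k E).obj m i) : f.map t = g.map t := by
  have key : ∀ {m : ℕ} {i : ℤ} (x : Pre k E m i),
      f.map (m := m) (i := i) (Quot.mk _ x) = g.map (m := m) (i := i) (Quot.mk _ x) := by
    intro m i x
    induction x with
    | zero => exact (map_zero f.map).trans (map_zero g.map).symm
    | add x y hx hy =>
      exact (f.map.map_add _ _).trans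
        ((congrArg₂ (· + ·) hx hy).trans (g.map.map_add _ _).symm)
    | smul c x hx =>
      exact (f.map.map_smul c _).trans ((congrArg (c • ·) hx).trans (g.map.map_smul c _).symm)
    | one => exact f.map_one.trans g.map_one.symm
    | gen e => exact h e
    | comp a ha hl hp x y hx hy =>
      exact (f.map_comp a ha hl hp _ _).trans
        ((congrArg₂ (fun s t => P.comp a ha hl hp s t) hx hy).trans
          (g.map_comp a ha hl hp _ _).symm)
  obtain ⟨x⟩ := t
  exact key x

/-- Given subspaces `W p m i` of the generators (the generators of weight `p`), `IsMonomial W p t`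
says that `t` is an iterated partial composition of such generators whose weights add up to `p`. -/
inductive IsMonomial (W : ℕ → ∀ m i, Submodule k (E m i)) :
    ℕ → ∀ {m : ℕ} {i : ℤ}, (freeOperad k E).obj m i → Prop
  | one : IsMonomial W 0 (freeOperad k E).one
  | gen {p m : ℕ} {i : ℤ} (e : E m i) : e ∈ W p m i → IsMonomial W p (gen k E e)
  | comp {p q m n l : ℕ} {i j f : ℤ} (a : ℕ) (ha : a < m) (hl : m + n = l + 1) (hf : i + j = f)
      (x : (freeOperad k E).obj m i) (y : (freeOperad k E).obj n j) :
      IsMonomial W p x → IsMonomial W q y →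
      IsMonomial W (p + q) ((freeOperad k E).comp a ha hl hf x y)

/-- The weight `p` part of `T(E)` for the weight grading induced by a weight grading `W`
of the generators. -/
def weightPart (W : ℕ → ∀ m i, Submodule k (E m i)) (p m : ℕ) (i : ℤ) :
    Submodule k ((freeOperad k E).obj m i) :=
  Submodule.span k {t | IsMonomial W p t}

variable (k E) in
/-- `T(E)^(p)`: the span of the tree tensors with exactly `p` internal vertices, that is,
the weight `p` part when all generators have weight one. -/
def vertexPart (p m : ℕ) (i : ℤ) : Submodule k ((freeOperad k E).obj m i) :=
  weightPart (fun q _ _ => if q = 1 then ⊤ else ⊥) p m i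

variable (k E) in
/-- The decomposable elements of `T(E)`: the span of the tree tensors with at least two
internal vertices. -/
def decomposables (m : ℕ) (i : ℤ) : Submodule k ((freeOperad k E).obj m i) :=
  ⨆ (p : ℕ) (_ : 2 ≤ p), vertexPart k E p m i

end

end FreeOperad

section

variable {k : Type v} [Field k]

/-- The quadratic operad `P(X, R) = T(X) / (R)`: the largest quotient operad of `T(X)` in which
the subcollection `R` (contained in `T(X)^(2)`) vanishes. -/
def quadraticOperad (X : ℕ → ℤ → Type u)
    [∀ m i, AddCommGroup (X m i)] [∀ m i, Module k (X m i)]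
    (R : ∀ m i, Submodule k ((freeOperad k X).obj m i)) : NSOperad.{v, max u v} k :=
  (freeOperad k X).quotient ((freeOperad k X).idealSpan R)
    ((freeOperad k X).idealSpan_isIdeal R)

/-- The weight `p` part of `P(X, R)`: the image of `T(X)^(p)`. -/
def quadraticOperad.weightPart (X : ℕ → ℤ → Type u)
    [∀ m i, AddCommGroup (X m i)] [∀ m i, Module k (X m i)]
    (R : ∀ m i, Submodule k ((freeOperad k X).obj m i)) (p m : ℕ) (i : ℤ) :
    Submodule k ((quadraticOperad X R).obj m i) :=
  (FreeOperad.vertexPart k X p m i).map ((freeOperad k X).idealSpan R m i).mkQ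

/-- A minimal model of a graded operad `P` (with zero differential): a free operad `T(E)` on a
collection `E` with `E(0) = E(1) = 0`, a differential on it that sends generators to
decomposable elements, and a weak equivalence `(T(E), ∂) → (P, 0)`. -/
structure MinimalModel (P : NSOperad.{v, w} k) where
  E : ℕ → ℤ → Type u
  [addCommGroup : ∀ m i, AddCommGroup (E m i)]
  [module : ∀ m i, Module k (E m i)]
  eq_zero : ∀ (m : ℕ) (i : ℤ), m < 2 → Subsingleton (E m i)
  diff : (freeOperad k E).Differential
  decomposable : ∀ {m : ℕ} {i j : ℤ} (h : j + 1 = i) (e : E m i),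
    diff.d h (FreeOperad.gen k E e) ∈ FreeOperad.decomposables k E m j
  proj : NSOperad.DGHom diff (NSOperad.Differential.zero P)
  quasiIso : proj.IsQuasiIso

attribute [instance] MinimalModel.addCommGroup MinimalModel.module

/-- `W` is a weight grading of a minimal model of `P(X, R)`: the space of generators of each arity
and degree is the direct sum of the subspaces `W p m i` of generators of weight `p`, and, for the
induced weight grading of `T(E)`, both the differential and the map to `P(X, R)` preserve
weights. -/
structure MinimalModel.IsWeightGrading {X : ℕ → ℤ → Type u}
    [∀ m i, AddCommGroup (X m i)] [∀ m i, Module k (X m i)]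
    {R : ∀ m i, Submodule k ((freeOperad k X).obj m i)}
    (M : MinimalModel.{w', v, max u v} (quadraticOperad X R))
    (W : ℕ → ∀ m i, Submodule k (M.E m i)) : Prop where
  isInternal : ∀ (m : ℕ) (i : ℤ), DirectSum.IsInternal (fun p => W p m i)
  diff_mem : ∀ {p m : ℕ} {i j : ℤ} (h : j + 1 = i) (t : (freeOperad k M.E).obj m i),
    t ∈ FreeOperad.weightPart W p m i → M.diff.d h t ∈ FreeOperad.weightPart W p m j
  proj_mem : ∀ {p m : ℕ} {i : ℤ} (t : (freeOperad k M.E).obj m i),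
    t ∈ FreeOperad.weightPart W p m i → M.proj.map t ∈ quadraticOperad.weightPart X R p m i

end

/-! Put `c = n - 1`. A tree with `p` vertices of arity `n` has `p * c + 1` leaves, so weight in
`T(X)` and in `P` is the same datum as arity. The engine is minimality (`eq_zero_of_products`): if a
generator `e` and a sum of products `δ` have the same boundary and the same image under `ρ`, then `e
- δ` is a cycle killed by `ρ`, hence a boundary, hence a sum of products; but generators are
independent of products, so `e = 0`.

By induction on arity, `E` lives in the arities `p * c + 1`, and grading by arity is a weight
grading. Conversely, a generator of weight `p` in arity `q * c + 1` with `p ≠ q` has a boundary of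
weight both `p` and `q` and an image under `ρ` in a zero space, so it vanishes
(`IsWeightGrading.eq_bot`). It remains to bound degrees in arities `c + 1`, `2 * c + 1` and `3 * c +
1`.

The projection `T(X) → P` lifts to `φ : T(X) → T(E)` with values in cycles (`exists_lift`), so
beyond arity `c + 1` only the boundary of `e` has to be matched (`eq_zero_of_diff_eq`). Products of
weight 2 have degree `2d`, so generators of weight 2 have degree `2d + 1`. Products of weight 3 have
degree `3d` or `3d + 1`, so generators of weight 3 have degree `3d + 1` or `3d + 2`. To exclude `3d
+ 1`, write `∂e = φ(y)`. Then `y` lies in the ideal `(R)`; the elements of `R` lift to boundaries,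
and by the Leibniz rule `φ(y)` is the boundary of a sum of products
(`exists_boundary_of_mem_idealSpan`). Hence `e = 0`. -/

namespace FreeOperad

/-! ### Decomposition of a free operad into identity, generators and products. -/

section Structure

variable {k : Type v} [Field k] {E : ℕ → ℤ → Type u}
  [∀ m i, AddCommGroup (E m i)] [∀ m i, Module k (E m i)]

/-- A family of subspaces of `T(E)` that contains the identity and the generators and is closed
under partial compositions is everything. -/
theorem mem_of_closed (S : ∀ m i, Submodule k ((freeOperad k E).obj m i))
    (hone : (freeOperad k E).one ∈ S 1 0)
    (hgen : ∀ {m : ℕ} {i : ℤ} (e : E m i), gen k E e ∈ S m i)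
    (hcomp : ∀ {m n l : ℕ} {i j p : ℤ} (a : ℕ) (ha : a < m) (hl : m + n = l + 1)
      (hp : i + j = p) (x : (freeOperad k E).obj m i) (y : (freeOperad k E).obj n j),
      x ∈ S m i → y ∈ S n j → (freeOperad k E).comp a ha hl hp x y ∈ S l p)
    {m : ℕ} {i : ℤ} (t : (freeOperad k E).obj m i) : t ∈ S m i := by
  have key : ∀ {m : ℕ} {i : ℤ} (x : Pre k E m i),
      (Quot.mk _ x : (freeOperad k E).obj m i) ∈ S m i := by
    intro m i x
    induction x with
    | zero => exact (S _ _).zero_mem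
    | add x y hx hy => exact (S _ _).add_mem hx hy
    | smul c x hx => exact (S _ _).smul_mem c hx
    | one => exact hone
    | gen e => exact hgen e
    | comp a ha hl hp x y hx hy => exact hcomp a ha hl hp _ _ hx hy
  obtain ⟨x⟩ := t
  exact key x

variable (k E) in
/-- The predicate of being the identity operation, without prescribing arity and degree. -/
inductive IsOne : ∀ {m : ℕ} {i : ℤ}, (freeOperad k E).obj m i → Prop
  | one : IsOne (freeOperad k E).one

variable (k E) in
/-- The span of the partial compositions of two operations of arity at least two. -/
def products (l : ℕ) (p : ℤ) : Submodule k ((freeOperad k E).obj l p) :=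
  Submodule.span k {t | ∃ (m n : ℕ) (i j : ℤ) (a : ℕ) (ha : a < m) (hl : m + n = l + 1)
    (hp : i + j = p) (x : (freeOperad k E).obj m i) (y : (freeOperad k E).obj n j),
    2 ≤ m ∧ 2 ≤ n ∧ (freeOperad k E).comp a ha hl hp x y = t}

theorem comp_mem_products {m n l : ℕ} {i j p : ℤ} (a : ℕ) (ha : a < m) (hl : m + n = l + 1)
    (hp : i + j = p) (x : (freeOperad k E).obj m i) (y : (freeOperad k E).obj n j)
    (hm : 2 ≤ m) (hn : 2 ≤ n) : (freeOperad k E).comp a ha hl hp x y ∈ products k E l p :=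
  Submodule.subset_span ⟨m, n, i, j, a, ha, hl, hp, x, y, hm, hn, rfl⟩

/-- To place the products in a subspace it suffices to treat single partial compositions. -/
theorem products_le {l : ℕ} {p : ℤ} {S : Submodule k ((freeOperad k E).obj l p)}
    (h : ∀ {m n : ℕ} {i j : ℤ} (a : ℕ) (ha : a < m) (hl : m + n = l + 1)
      (hp : i + j = p) (x : (freeOperad k E).obj m i) (y : (freeOperad k E).obj n j),
      2 ≤ m → 2 ≤ n → (freeOperad k E).comp a ha hl hp x y ∈ S) :
    products k E l p ≤ S := by
  refine Submodule.span_le.2 ?_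
  rintro _ ⟨m, n, i, j, a, ha, hl, hp, x, y, hm, hn, rfl⟩
  exact h a ha hl hp x y hm hn

theorem products_eq_bot_of_lt {l : ℕ} (hl : l < 2) (p : ℤ) : products k E l p = ⊥ :=
  le_bot_iff.1 (products_le fun a ha hl' hp x y hm hn => by omega)

/-- The sum of the three subspaces is closed under composition: the identity returns the other
factor, and in the remaining summands the factors of arity below two vanish, so only genuine
products are left. -/
theorem mem_span_isOne_sup (hE : ∀ (m : ℕ) (i : ℤ), m < 2 → Subsingleton (E m i))
    {m : ℕ} {i : ℤ} (t : (freeOperad k E).obj m i) :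
    t ∈ Submodule.span k {t | IsOne k E t} ⊔ (LinearMap.range (gen k E) ⊔ products k E m i) := by
  refine mem_of_closed (fun m i => Submodule.span k {t | IsOne k E t} ⊔
    (LinearMap.range (gen k E) ⊔ products k E m i)) ?_ ?_ ?_ t
  · exact Submodule.mem_sup_left (Submodule.subset_span IsOne.one)
  · exact fun e => Submodule.mem_sup_right (Submodule.mem_sup_left ⟨e, rfl⟩)
  · clear t m i
    intro m n l i j p a ha hl hp x y hx hy
    obtain ⟨x₁, hx₁, x₂, hx₂, rfl⟩ := Submodule.mem_sup.1 hx
    have hzero : ∀ {m : ℕ} {i : ℤ}, m < 2 → ∀ x : (freeOperad k E).obj m i,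
        x ∈ LinearMap.range (gen k E) ⊔ products k E m i → x = 0 := by
      intro m i hm x hx
      rw [products_eq_bot_of_lt hm, sup_bot_eq] at hx
      obtain ⟨e, rfl⟩ := hx
      have := hE m i hm
      rw [Subsingleton.elim e 0, map_zero]
    rw [map_add, LinearMap.add_apply]
    refine Submodule.add_mem _ ?_ ?_
    · clear hx hx₂
      induction hx₁ using Submodule.span_induction with
      | mem x hx =>
        obtain ⟨⟩ := hx
        obtain rfl : a = 0 := by omega
        obtain rfl : n = l := by omega
        obtain rfl : j = p := by omega
        rwa [NSOperad.one_comp]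
      | zero => rw [map_zero, LinearMap.zero_apply]; exact Submodule.zero_mem _
      | add x x' _ _ h h' => rw [map_add, LinearMap.add_apply]; exact Submodule.add_mem _ h h'
      | smul c x _ h => rw [map_smul, LinearMap.smul_apply]; exact Submodule.smul_mem _ c h
    · clear hx hx₁
      obtain ⟨y₁, hy₁, y₂, hy₂, rfl⟩ := Submodule.mem_sup.1 hy
      rw [map_add]
      refine Submodule.add_mem _ ?_ ?_
      · clear hy hy₂
        induction hy₁ using Submodule.span_induction with
        | mem y hy =>
          obtain ⟨⟩ := hy
          obtain rfl := Nat.succ.inj hl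
          obtain rfl := (add_zero _).symm.trans hp
          rw [NSOperad.comp_one]
          exact Submodule.mem_sup_right hx₂
        | zero => rw [map_zero]; exact Submodule.zero_mem _
        | add x x' _ _ h h' => rw [map_add]; exact Submodule.add_mem _ h h'
        | smul c x _ h => rw [map_smul]; exact Submodule.smul_mem _ c h
      · by_cases hm : m < 2
        · rw [hzero hm x₂ hx₂, map_zero, LinearMap.zero_apply]
          exact Submodule.zero_mem _
        by_cases hn : n < 2
        · rw [hzero hn y₂ hy₂, map_zero]
          exact Submodule.zero_mem _
        exact Submodule.mem_sup_right (Submodule.mem_sup_right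
          (comp_mem_products a ha hl hp x₂ y₂ (by omega) (by omega)))

theorem span_isOne_eq_bot {m : ℕ} {i : ℤ} (hm : m ≠ 1) :
    Submodule.span k {t : (freeOperad k E).obj m i | IsOne k E t} = ⊥ := by
  refine Submodule.span_eq_bot.2 fun x hx => ?_
  obtain ⟨⟩ := hx
  exact absurd rfl hm

/-- In arity at least two, every operation is a generator plus products. -/
theorem exists_gen_add (hE : ∀ (m : ℕ) (i : ℤ), m < 2 → Subsingleton (E m i))
    {m : ℕ} {i : ℤ} (hm : m ≠ 1) (t : (freeOperad k E).obj m i) :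
    ∃ (e : E m i), ∃ δ ∈ products k E m i, t = gen k E e + δ := by
  have h := mem_span_isOne_sup hE t
  rw [span_isOne_eq_bot hm, bot_sup_eq] at h
  obtain ⟨_, ⟨e, rfl⟩, δ, hδ, rfl⟩ := Submodule.mem_sup.1 h
  exact ⟨e, δ, hδ, rfl⟩

theorem eq_zero_of_arity_zero (hE : ∀ (m : ℕ) (i : ℤ), m < 2 → Subsingleton (E m i))
    {m : ℕ} {i : ℤ} (hm : m = 0) (t : (freeOperad k E).obj m i) : t = 0 := by
  subst hm
  obtain ⟨e, δ, hδ, rfl⟩ := exists_gen_add hE (by omega) t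
  have := hE 0 i (by omega)
  rw [products_eq_bot_of_lt (by omega)] at hδ
  rw [Subsingleton.elim e 0, map_zero, (Submodule.mem_bot k).1 hδ, add_zero]

theorem mem_span_isOne (hE : ∀ (m : ℕ) (i : ℤ), m < 2 → Subsingleton (E m i))
    {i : ℤ} (t : (freeOperad k E).obj 1 i) :
    t ∈ Submodule.span k {t : (freeOperad k E).obj 1 i | IsOne k E t} := by
  have h := mem_span_isOne_sup hE t
  rw [products_eq_bot_of_lt (by omega), sup_bot_eq] at h
  obtain ⟨x, hx, _, ⟨e, rfl⟩, rfl⟩ := Submodule.mem_sup.1 h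
  have := hE 1 i (by omega)
  rwa [Subsingleton.elim e 0, map_zero, add_zero]

/-! ### Square-zero operads and the independence of generators from products. -/

/-- The component of `squareZero k V` of arity `m` and degree `i`. -/
def squareZeroObj (k : Type v) [Field k] (V : Type w) [AddCommGroup V] [Module k V]
    (m : ℕ) (i : ℤ) : Submodule k (k × V) :=
  ⨅ (_ : ¬ (m = 1 ∧ i = 0)), LinearMap.ker (LinearMap.fst k k V)

theorem mem_squareZeroObj {V : Type w} [AddCommGroup V] [Module k V] {m : ℕ} {i : ℤ}
    {x : k × V} : x ∈ squareZeroObj k V m i ↔ (¬ (m = 1 ∧ i = 0) → x.1 = 0) := by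
  simp only [squareZeroObj, Submodule.mem_iInf, LinearMap.mem_ker, LinearMap.fst_apply]

/-- The partial compositions of `squareZero k V`. -/
def squareZeroComp (k : Type v) [Field k] (V : Type w) [AddCommGroup V] [Module k V]
    {m n l : ℕ} {i j p : ℤ} (hl : m + n = l + 1) (hp : i + j = p) :
    squareZeroObj k V m i →ₗ[k] squareZeroObj k V n j →ₗ[k] squareZeroObj k V l p :=
  LinearMap.mk₂ k
    (fun x y => ⟨(x.1.1 * y.1.1, x.1.1 • y.1.2 + y.1.1 • x.1.2), by
      obtain ⟨x, hx⟩ := x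
      obtain ⟨y, hy⟩ := y
      rw [mem_squareZeroObj] at hx hy ⊢
      intro h
      by_cases h' : m = 1 ∧ i = 0
      · change x.1 * y.1 = 0
        rw [hy (by omega), mul_zero]
      · change x.1 * y.1 = 0
        rw [hx h', zero_mul]⟩)
    (fun x x' y => Subtype.ext (Prod.ext (add_mul _ _ _) (by
      change (x.1.1 + x'.1.1) • y.1.2 + y.1.1 • (x.1.2 + x'.1.2) =
        (x.1.1 • y.1.2 + y.1.1 • x.1.2) + (x'.1.1 • y.1.2 + y.1.1 • x'.1.2)
      module)))
    (fun c x y => Subtype.ext (Prod.ext (mul_assoc _ _ _) (by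
      change (c * x.1.1) • y.1.2 + y.1.1 • (c • x.1.2) = c • (x.1.1 • y.1.2 + y.1.1 • x.1.2)
      module)))
    (fun x y y' => Subtype.ext (Prod.ext (mul_add _ _ _) (by
      change x.1.1 • (y.1.2 + y'.1.2) + (y.1.1 + y'.1.1) • x.1.2 =
        (x.1.1 • y.1.2 + y.1.1 • x.1.2) + (x.1.1 • y'.1.2 + y'.1.1 • x.1.2)
      module)))
    (fun c x y => Subtype.ext (Prod.ext (mul_left_comm _ _ _) (by
      change x.1.1 • (c • y.1.2) + (c * y.1.1) • x.1.2 = c • (x.1.1 • y.1.2 + y.1.1 • x.1.2)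
      module)))

/-- The operad `k ⊕ V` in which any two elements of `V` compose to zero; a copy of `V` is placed in
each arity and degree, and `k` is spanned by the identity. -/
def squareZero (k : Type v) [Field k] (V : Type w) [AddCommGroup V] [Module k V] :
    NSOperad.{v, max v w} k where
  obj m i := squareZeroObj k V m i
  one := ⟨(1, 0), mem_squareZeroObj.2 fun h => absurd ⟨rfl, rfl⟩ h⟩
  comp _ _ hl hp := squareZeroComp k V hl hp
  one_comp h hl hp x := Subtype.ext (Prod.ext (one_mul _) (by
    change (1 : k) • x.1.2 + x.1.1 • (0 : V) = x.1.2
    module))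
  comp_one a ha hl hp x := Subtype.ext (Prod.ext (mul_one _) (by
    change x.1.1 • (0 : V) + (1 : k) • x.1.2 = x.1.2
    module))
  comp_seq a b ha hb hab hl hl' ht ht' hf hf' hg hg' x y z :=
    Subtype.ext (Prod.ext (mul_assoc _ _ _) (by
      change (x.1.1 * y.1.1) • z.1.2 + z.1.1 • (x.1.1 • y.1.2 + y.1.1 • x.1.2) =
        x.1.1 • (y.1.1 • z.1.2 + z.1.1 • y.1.2) + (y.1.1 * z.1.1) • x.1.2
      module))
  comp_par {m n r l l' t i j q f f' g} a c s ha hc _ _ hs ha' hl hl' ht ht' hf hf' hg hg' x y z := by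
    have hy := mem_squareZeroObj.1 y.2
    have hz := mem_squareZeroObj.1 z.2
    refine Subtype.ext (Prod.ext ?_ ?_)
    · change x.1.1 * y.1.1 * z.1.1 = (-1) ^ (j * q) * (x.1.1 * z.1.1 * y.1.1)
      -- The Koszul sign can differ from one only when both degrees are nonzero, and scalar
      -- components vanish in nonzero degree.
      by_cases h : j = 0
      · have hs : (-1 : k) ^ (j * q) = 1 := by simp [h]
        rw [hs, one_mul, mul_right_comm]
      · rw [hy (fun h' => h h'.2), mul_zero, mul_zero, zero_mul, mul_zero]
    · change (x.1.1 * y.1.1) • z.1.2 + z.1.1 • (x.1.1 • y.1.2 + y.1.1 • x.1.2) =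
        ((-1 : k) ^ (j * q)) •
          ((x.1.1 * z.1.1) • y.1.2 + y.1.1 • (x.1.1 • z.1.2 + z.1.1 • x.1.2))
      by_cases h : j = 0
      · have hs : (-1 : k) ^ (j * q) = 1 := by simp [h]
        rw [hs]
        module
      by_cases h' : q = 0
      · have hs : (-1 : k) ^ (j * q) = 1 := by simp [h']
        rw [hs]
        module
      rw [hy (fun h' => h h'.2), hz (fun h => h' h.2)]
      simp

variable (k E) in
/-- The projection of `T(E)` to the generators of arity `m` and degree `i`. -/
def linearPart (m : ℕ) (i : ℤ) : (freeOperad k E).Hom (squareZero k (E m i)) :=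
  lift (squareZero k (E m i)) fun {m' i'} =>
    (LinearMap.inr k k (E m i) ∘ₗ
      (if h : m' = m ∧ i' = i then
        { toFun := fun e => h.2 ▸ h.1 ▸ e
          map_add' := by obtain ⟨rfl, rfl⟩ := h; exact fun _ _ => rfl
          map_smul' := by obtain ⟨rfl, rfl⟩ := h; exact fun _ _ => rfl }
      else 0)).codRestrict (squareZeroObj k (E m i) m' i')
        (fun e => mem_squareZeroObj.2 fun _ => rfl)

theorem linearPart_gen {m : ℕ} {i : ℤ} (e : E m i) :
    ((linearPart k E m i).map (gen k E e)).1 = (0, e) := by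
  refine Prod.ext rfl ?_
  change (if h : m = m ∧ i = i then _ else _ : E m i →ₗ[k] E m i) e = e
  rw [dif_pos ⟨rfl, rfl⟩]
  rfl

theorem fst_linearPart {m m' : ℕ} {i i' : ℤ} (t : (freeOperad k E).obj m' i') (hm : m' ≠ 1) :
    ((linearPart k E m i).map t).1.1 = 0 := by
  have h := ((linearPart k E m i).map t).2
  exact mem_squareZeroObj.1 h (by omega)

/-- Both factors have arity at least two, hence no scalar component, and two elements of `V` compose
to zero. -/
theorem linearPart_eq_zero_of_mem_products {m : ℕ} {i : ℤ} {t : (freeOperad k E).obj m i}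
    (ht : t ∈ products k E m i) : (linearPart k E m i).map t = 0 := by
  have h : products k E m i ≤ LinearMap.ker (linearPart k E m i).map := by
    refine products_le fun a ha hl hp x y hm hn => ?_
    rw [LinearMap.mem_ker, NSOperad.Hom.map_comp]
    refine Subtype.ext (Prod.ext ?_ ?_)
    · change _ * _ = (0 : k)
      rw [fst_linearPart x (by omega), zero_mul]
    · change _ • _ + _ • _ = (0 : E m i)
      rw [fst_linearPart x (by omega), fst_linearPart y (by omega), zero_smul, zero_smul, add_zero]
  exact h ht

/-- Generators are linearly independent from products. -/
theorem eq_zero_of_gen_mem_products {m : ℕ} {i : ℤ} {e : E m i}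
    (h : gen k E e ∈ products k E m i) : e = 0 := by
  have h' := linearPart_gen (k := k) e
  rw [linearPart_eq_zero_of_mem_products h] at h'
  exact (congrArg Prod.snd h').symm

/-- The scalar statement is what makes the induction work: with at least two vertices in all, either
one factor has none and the other has two or more, or both factors have a vertex and so no scalar
component. -/
theorem IsMonomial.linearPart_eq_zero {m : ℕ} {i : ℤ} {p m' : ℕ} {i' : ℤ}
    {t : (freeOperad k E).obj m' i'}
    (ht : IsMonomial (fun q m i => if q = 1 then (⊤ : Submodule k (E m i)) else ⊥) p t) :
    (p ≠ 0 → ((linearPart k E m i).map t).1.1 = 0) ∧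
      (2 ≤ p → (linearPart k E m i).map t = 0) := by
  induction ht with
  | one => exact ⟨fun h => absurd rfl h, fun h => absurd h (by omega)⟩
  | @gen p m' i' e he =>
    refine ⟨fun _ => rfl, fun h => ?_⟩
    rw [if_neg (by omega), Submodule.mem_bot] at he
    rw [he, map_zero, map_zero]
  | @comp p q m n l i j f a ha hl hf x y _ _ hx hy =>
    rw [NSOperad.Hom.map_comp]
    refine ⟨fun h => ?_, fun h => ?_⟩
    · change _ * _ = (0 : k)
      by_cases hp : p = 0
      · rw [hy.1 (by omega), mul_zero]
      · rw [hx.1 hp, zero_mul]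
    · by_cases hp : p = 0
      · rw [hy.2 (by omega), map_zero]
      by_cases hq : q = 0
      · rw [hx.2 (by omega), map_zero, LinearMap.zero_apply]
      refine Subtype.ext (Prod.ext ?_ ?_)
      · change _ * _ = (0 : k)
        rw [hx.1 hp, zero_mul]
      · change _ • _ + _ • _ = (0 : E _ _)
        rw [hx.1 hp, hy.1 hq, zero_smul, zero_smul, add_zero]

/-- Decomposables have zero linear part, and outside arity one an element with zero linear part is a
sum of products. -/
theorem decomposables_le_products (hE : ∀ (m : ℕ) (i : ℤ), m < 2 → Subsingleton (E m i))
    {m : ℕ} {i : ℤ} (hm : m ≠ 1) : decomposables k E m i ≤ products k E m i := by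
  intro t ht
  have h : decomposables k E m i ≤ LinearMap.ker (linearPart k E m i).map := by
    refine iSup₂_le fun p hp => Submodule.span_le.2 fun t ht => ?_
    exact (IsMonomial.linearPart_eq_zero ht).2 hp
  have ht' : (linearPart k E m i).map t = 0 := h ht
  obtain ⟨e, δ, hδ, rfl⟩ := exists_gen_add hE hm t
  rw [map_add, linearPart_eq_zero_of_mem_products hδ, add_zero] at ht'
  have h' := linearPart_gen (k := k) e
  rw [ht'] at h'
  obtain rfl : e = 0 := (congrArg Prod.snd h').symm
  rwa [map_zero, zero_add]

end Structure

end FreeOperad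

namespace FreeOperad

/-! ### Weight gradings of a free operad. -/

section Weights

variable {k : Type v} [Field k] {E : ℕ → ℤ → Type u}
  [∀ m i, AddCommGroup (E m i)] [∀ m i, Module k (E m i)]
  {W : ℕ → ∀ m i, Submodule k (E m i)}

theorem comp_mem_weightPart {p q m n l : ℕ} {i j f : ℤ} (a : ℕ) (ha : a < m) (hl : m + n = l + 1)
    (hf : i + j = f) {x : (freeOperad k E).obj m i} {y : (freeOperad k E).obj n j}
    (hx : x ∈ weightPart W p m i) (hy : y ∈ weightPart W q n j) :
    (freeOperad k E).comp a ha hl hf x y ∈ weightPart W (p + q) l f := by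
  have h : Submodule.map₂ ((freeOperad k E).comp a ha hl hf) (weightPart W p m i)
      (weightPart W q n j) ≤ weightPart W (p + q) l f := by
    rw [weightPart, weightPart, Submodule.map₂_span_span, Submodule.span_le]
    rintro _ ⟨x, hx, y, hy, rfl⟩
    exact Submodule.subset_span (IsMonomial.comp a ha hl hf x y hx hy)
  exact h (Submodule.apply_mem_map₂ _ hx hy)

/-- If the weights exhaust the generators, they exhaust the free operad. -/
theorem iSup_weightPart (hW : ∀ m i, ⨆ p, W p m i = ⊤) (m : ℕ) (i : ℤ) :
    ⨆ p, weightPart W p m i = ⊤ := by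
  refine eq_top_iff.2 fun t _ => mem_of_closed (fun m i => ⨆ p, weightPart W p m i) ?_ ?_ ?_ t
  · exact Submodule.mem_iSup_of_mem 0 (Submodule.subset_span IsMonomial.one)
  · intro m i e
    have h : ⨆ p, W p m i ≤ (⨆ p, weightPart W p m i).comap (gen k E) :=
      iSup_le fun p e he => Submodule.mem_iSup_of_mem p
        (Submodule.subset_span (IsMonomial.gen e he))
    exact h (by rw [hW]; trivial)
  · intro m n l i j p a ha hl hp x y hx hy
    have h : Submodule.map₂ ((freeOperad k E).comp a ha hl hp) (⨆ p, weightPart W p m i)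
        (⨆ p, weightPart W p n j) ≤ ⨆ q, weightPart W q l p := by
      simp only [Submodule.map₂_iSup_left, Submodule.map₂_iSup_right]
      refine iSup_le fun q => iSup_le fun r => Submodule.map₂_le.2 fun x hx y hy => ?_
      exact Submodule.mem_iSup_of_mem _ (comp_mem_weightPart a ha hl hp hx hy)
    exact h (Submodule.apply_mem_map₂ _ hx hy)

/-- If the weight of a generator of arity `m < N` is `(m - 1) / c`, then so is the weight of a
nonzero monomial of arity `m < N`. -/
theorem IsMonomial.arity_eq (hE : ∀ (m : ℕ) (i : ℤ), m < 2 → Subsingleton (E m i)) {c N : ℕ}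
    (hW : ∀ p m i, m < N → m ≠ p * c + 1 → W p m i = ⊥) {p m : ℕ} {i : ℤ}
    {t : (freeOperad k E).obj m i} (ht : IsMonomial W p t) (hm : m < N) (h : t ≠ 0) :
    m = p * c + 1 := by
  induction ht with
  | one => simp
  | @gen p m i e he =>
    by_contra hne
    rw [hW p m i hm hne, Submodule.mem_bot] at he
    exact h (by rw [he, map_zero])
  | @comp p q m n l i j f a ha hl hf x y _ _ hx hy =>
    have hx0 : x ≠ 0 := fun h' => h (by rw [h', map_zero, LinearMap.zero_apply])
    have hy0 : y ≠ 0 := fun h' => h (by rw [h', map_zero])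
    -- Operations of arity zero vanish, so neither factor has larger arity than the composite and
    -- both stay below `N`.
    have hn : n ≠ 0 := fun h' => hy0 (eq_zero_of_arity_zero hE h' y)
    have := hx (by omega) hx0
    have := hy (by omega) hy0
    rw [add_mul]
    omega

/-- The cutoff `N` is for induction on arity, where the weights of generators are known only in
smaller arities; taking `N = m + 1` covers the case where they are known throughout. -/
theorem weightPart_eq_bot (hE : ∀ (m : ℕ) (i : ℤ), m < 2 → Subsingleton (E m i)) {c N : ℕ}
    (hW : ∀ p m i, m < N → m ≠ p * c + 1 → W p m i = ⊥) {p m : ℕ} (i : ℤ) (hm : m < N)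
    (h : m ≠ p * c + 1) : weightPart W p m i = ⊥ :=
  Submodule.span_eq_bot.2 fun _ ht => by_contra fun h0 => h (ht.arity_eq hE hW hm h0)

theorem weightPart_eq_top (hE : ∀ (m : ℕ) (i : ℤ), m < 2 → Subsingleton (E m i)) {c N : ℕ}
    (hc : 0 < c) (hW : ∀ p m i, m < N → m ≠ p * c + 1 → W p m i = ⊥)
    (hW' : ∀ m i, ⨆ p, W p m i = ⊤) {p m : ℕ} (i : ℤ) (hm : m < N)
    (h : m = p * c + 1) : weightPart W p m i = ⊤ := by
  rw [eq_top_iff, ← iSup_weightPart hW' m i]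
  refine iSup_le fun q => ?_
  by_cases hq : q = p
  · rw [hq]
  · rw [weightPart_eq_bot hE hW i hm]
    · exact bot_le
    · rw [h]
      intro h'
      exact hq (Nat.eq_of_mul_eq_mul_right hc (by omega))

theorem eq_zero_of_arity_ne (hE : ∀ (m : ℕ) (i : ℤ), m < 2 → Subsingleton (E m i)) {c N : ℕ}
    (hW : ∀ p m i, m < N → m ≠ p * c + 1 → W p m i = ⊥)
    (hW' : ∀ m i, ⨆ p, W p m i = ⊤) {m : ℕ} {i : ℤ} (hm : m < N)
    (h : ∀ p, m ≠ p * c + 1) (t : (freeOperad k E).obj m i) : t = 0 := by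
  have ht : t ∈ ⨆ p, weightPart W p m i := by rw [iSup_weightPart hW']; trivial
  simpa [weightPart_eq_bot hE hW i hm (h _)] using ht

/-- The endomorphism of `T(E)` that multiplies the part of weight `p` by `2 ^ p`. -/
noncomputable def weightScaling (hW : ∀ (m : ℕ) (i : ℤ), DirectSum.IsInternal (fun p => W p m i)) :
    (freeOperad k E).Hom (freeOperad k E) :=
  lift (freeOperad k E) fun {m i} => gen k E ∘ₗ
    (DirectSum.toModule k ℕ (E m i) (fun p => (2 : k) ^ p • (W p m i).subtype)) ∘ₗ
    (LinearEquiv.ofBijective (DirectSum.coeLinearMap fun p => W p m i) (hW m i)).symm.toLinearMap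

theorem IsMonomial.weightScaling_apply
    (hW : ∀ (m : ℕ) (i : ℤ), DirectSum.IsInternal (fun p => W p m i))
    {p m : ℕ} {i : ℤ} {t : (freeOperad k E).obj m i} (ht : IsMonomial W p t) :
    (weightScaling hW).map t = (2 : k) ^ p • t := by
  induction ht with
  | one => rw [NSOperad.Hom.map_one, pow_zero, one_smul]
  | @gen p m i e he =>
    have h : (LinearEquiv.ofBijective (DirectSum.coeLinearMap fun p => W p m i) (hW m i)).symm e
        = DirectSum.lof k ℕ (fun p => W p m i) p ⟨e, he⟩ := by
      rw [LinearEquiv.symm_apply_eq]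
      exact (DirectSum.coeLinearMap_lof (fun p => W p m i) p ⟨e, he⟩).symm
    rw [weightScaling, lift_gen, LinearMap.comp_apply, LinearMap.comp_apply,
      LinearEquiv.coe_coe, h, DirectSum.toModule_lof, LinearMap.smul_apply, map_smul]
    rfl
  | @comp p q m n l i j f a ha hl hf x y _ _ hx hy =>
    rw [NSOperad.Hom.map_comp, hx, hy, map_smul, map_smul, LinearMap.smul_apply, smul_smul,
      pow_add, mul_comm]

theorem weightScaling_apply (hW : ∀ (m : ℕ) (i : ℤ), DirectSum.IsInternal (fun p => W p m i))
    {p m : ℕ} {i : ℤ} {t : (freeOperad k E).obj m i} (ht : t ∈ weightPart W p m i) :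
    (weightScaling hW).map t = (2 : k) ^ p • t := by
  induction ht using Submodule.span_induction with
  | zero => rw [map_zero, smul_zero]
  | add x y _ _ hx hy => rw [map_add, hx, hy, smul_add]
  | smul c x _ hx => rw [map_smul, hx, smul_comm]
  | mem t ht => exact ht.weightScaling_apply hW

/-- The endomorphism `weightScaling` multiplies `t` by both `2 ^ p` and `2 ^ q`, which are distinct
in characteristic zero. -/
theorem eq_zero_of_mem_weightPart [CharZero k]
    (hW : ∀ (m : ℕ) (i : ℤ), DirectSum.IsInternal (fun p => W p m i))
    {p q m : ℕ} {i : ℤ} (hpq : p ≠ q) {t : (freeOperad k E).obj m i}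
    (hp : t ∈ weightPart W p m i) (hq : t ∈ weightPart W q m i) : t = 0 := by
  have h := (weightScaling_apply hW hp).symm.trans (weightScaling_apply hW hq)
  rw [← sub_eq_zero, ← sub_smul, smul_eq_zero, sub_eq_zero] at h
  refine h.resolve_left fun h' => hpq ?_
  have h2 : (2 : ℕ) ^ p = 2 ^ q := by exact_mod_cast h'
  exact Nat.pow_right_injective le_rfl h2

end Weights

end FreeOperad

namespace FreeOperad

/-! ### Products in operads concentrated in the arities `p * c + 1`. -/

section Products

variable {k : Type v} [Field k] {E : ℕ → ℤ → Type u}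
  [∀ m i, AddCommGroup (E m i)] [∀ m i, Module k (E m i)]
  {F : ℕ → ℤ → Type w} [∀ m i, AddCommGroup (F m i)] [∀ m i, Module k (F m i)]

theorem map_mem_products (f : (freeOperad k E).Hom (freeOperad k F)) {m : ℕ} {i : ℤ}
    {t : (freeOperad k E).obj m i} (ht : t ∈ products k E m i) :
    f.map t ∈ products k F m i := by
  have h : products k E m i ≤ (products k F m i).comap f.map :=
    products_le fun a ha hl hp x y hm hn => by
      rw [Submodule.mem_comap, f.map_comp]
      exact comp_mem_products a ha hl hp _ _ hm hn
  exact h ht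

/-- If `T(E)` is concentrated in the arities `p * c + 1`, then the products are spanned by
partial compositions of operations with such arities. -/
theorem products_le_of_arity {c : ℕ}
    (hE : ∀ {m : ℕ} {i : ℤ}, (∀ p, m ≠ p * c + 1) → ∀ t : (freeOperad k E).obj m i, t = 0)
    {r : ℕ} {f : ℤ} {S : Submodule k ((freeOperad k E).obj (r * c + 1) f)}
    (h : ∀ {p q : ℕ} {i j : ℤ} (a : ℕ) (ha : a < p * c + 1)
      (hl : (p * c + 1) + (q * c + 1) = (r * c + 1) + 1) (hf : i + j = f)
      (x : (freeOperad k E).obj (p * c + 1) i) (y : (freeOperad k E).obj (q * c + 1) j),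
      1 ≤ p → 1 ≤ q → p + q = r → (freeOperad k E).comp a ha hl hf x y ∈ S) :
    products k E (r * c + 1) f ≤ S := by
  refine products_le fun {m n i j} a ha hl hp x y hm hn => ?_
  by_cases hp' : ∃ p, m = p * c + 1
  swap
  · rw [hE (not_exists.1 hp') x, map_zero, LinearMap.zero_apply]
    exact S.zero_mem
  by_cases hq' : ∃ q, n = q * c + 1
  swap
  · rw [hE (not_exists.1 hq') y, map_zero]
    exact S.zero_mem
  obtain ⟨p, rfl⟩ := hp'
  obtain ⟨q, rfl⟩ := hq'
  have hc : 0 < c := Nat.pos_of_ne_zero (by rintro rfl; omega)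
  have hp0 : p ≠ 0 := by rintro rfl; omega
  have hq0 : q ≠ 0 := by rintro rfl; omega
  refine h a ha hl hp x y (by omega) (by omega) (Nat.eq_of_mul_eq_mul_right hc ?_)
  rw [add_mul]
  omega

theorem products_one_mul_eq_bot {c : ℕ}
    (hE : ∀ {m : ℕ} {i : ℤ}, (∀ p, m ≠ p * c + 1) → ∀ t : (freeOperad k E).obj m i, t = 0)
    (f : ℤ) : products k E (1 * c + 1) f = ⊥ :=
  le_bot_iff.1 (products_le_of_arity hE fun a ha hl hf x y hp hq hpq => by omega)

variable (k E) in
/-- All operations in arity `N`, and the products in the other arities. -/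
def productsOrArity (N m : ℕ) (i : ℤ) : Submodule k ((freeOperad k E).obj m i) :=
  if m = N then ⊤ else products k E m i

theorem products_le_productsOrArity (N m : ℕ) (i : ℤ) :
    products k E m i ≤ productsOrArity k E N m i := by
  rw [productsOrArity]
  split_ifs
  · exact le_top
  · exact le_rfl

theorem productsOrArity_eq_bot {N m : ℕ} (hN : 2 ≤ N) (hm : m < 2) (i : ℤ) :
    productsOrArity k E N m i = ⊥ := by
  rw [productsOrArity, if_neg (by omega), products_eq_bot_of_lt hm]

/-- Composing with arity at least two gives a product, arity zero contributes nothing, and arity one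
contains only multiples of the identity. -/
theorem comp_mem_productsOrArity_left (hE : ∀ (m : ℕ) (i : ℤ), m < 2 → Subsingleton (E m i))
    {N : ℕ} (hN : 2 ≤ N) {m n l : ℕ} {i j p : ℤ} (a : ℕ) (ha : a < m) (hl : m + n = l + 1)
    (hp : i + j = p) {x : (freeOperad k E).obj m i} (hx : x ∈ productsOrArity k E N m i)
    (y : (freeOperad k E).obj n j) :
    (freeOperad k E).comp a ha hl hp x y ∈ productsOrArity k E N l p := by
  by_cases hm : m < 2
  · rw [productsOrArity_eq_bot hN hm, Submodule.mem_bot] at hx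
    rw [hx, map_zero, LinearMap.zero_apply]
    exact Submodule.zero_mem _
  obtain rfl | rfl | hn : n = 0 ∨ n = 1 ∨ 2 ≤ n := by omega
  · rw [eq_zero_of_arity_zero hE rfl y, map_zero]
    exact Submodule.zero_mem _
  · have hy := mem_span_isOne hE y
    obtain rfl := Nat.succ.inj hl
    induction hy using Submodule.span_induction with
    | mem y hy =>
      cases hy
      obtain rfl := (add_zero _).symm.trans hp
      rwa [NSOperad.comp_one]
    | zero => rw [map_zero]; exact Submodule.zero_mem _
    | add x x' _ _ h h' => rw [map_add]; exact Submodule.add_mem _ h h'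
    | smul c x _ h => rw [map_smul]; exact Submodule.smul_mem _ c h
  · exact products_le_productsOrArity _ _ _ (comp_mem_products a ha hl hp x y (by omega) hn)

theorem comp_mem_productsOrArity_right (hE : ∀ (m : ℕ) (i : ℤ), m < 2 → Subsingleton (E m i))
    {N : ℕ} (hN : 2 ≤ N) {m n l : ℕ} {i j p : ℤ} (a : ℕ) (ha : a < m) (hl : m + n = l + 1)
    (hp : i + j = p) (x : (freeOperad k E).obj m i) {y : (freeOperad k E).obj n j}
    (hy : y ∈ productsOrArity k E N n j) :
    (freeOperad k E).comp a ha hl hp x y ∈ productsOrArity k E N l p := by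
  by_cases hn : n < 2
  · rw [productsOrArity_eq_bot hN hn, Submodule.mem_bot] at hy
    rw [hy, map_zero]
    exact Submodule.zero_mem _
  obtain rfl | hm : m = 1 ∨ 2 ≤ m := by omega
  · have hx := mem_span_isOne hE x
    obtain rfl : n = l := by omega
    induction hx using Submodule.span_induction with
    | mem x hx =>
      cases hx
      obtain rfl := (zero_add _).symm.trans hp
      obtain rfl : a = 0 := by omega
      rwa [NSOperad.one_comp]
    | zero => rw [map_zero, LinearMap.zero_apply]; exact Submodule.zero_mem _
    | add x x' _ _ h h' => rw [map_add, LinearMap.add_apply]; exact Submodule.add_mem _ h h'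
    | smul c x _ h => rw [map_smul, LinearMap.smul_apply]; exact Submodule.smul_mem _ c h
  · exact products_le_productsOrArity _ _ _ (comp_mem_products a ha hl hp x y hm (by omega))

end Products

end FreeOperad

/-! ### Quotients and quasi-isomorphisms to a zero differential. -/

namespace NSOperad

variable {k : Type v} [Field k]

/-- The projection of an operad to its quotient by an ideal. -/
def quotientHom (P : NSOperad.{v, w} k) (I : ∀ m i, Submodule k (P.obj m i)) (hI : P.IsIdeal I) :
    P.Hom (P.quotient I hI) where
  map {m i} := (I m i).mkQ
  map_one := rfl
  map_comp _ _ _ _ _ _ := rfl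

/-- The composition of morphisms of operads. -/
def Hom.comp {P : NSOperad.{v, w} k} {Q : NSOperad.{v, w'} k} {S : NSOperad.{v, u} k}
    (g : Q.Hom S) (f : P.Hom Q) : P.Hom S where
  map := g.map ∘ₗ f.map
  map_one := (congrArg g.map f.map_one).trans g.map_one
  map_comp a ha hl hp x y :=
    (congrArg g.map (f.map_comp a ha hl hp x y)).trans (g.map_comp a ha hl hp _ _)

/-- Cycles that a quasi-isomorphism to an operad with zero differential kills are boundaries. -/
theorem DGHom.IsQuasiIso.exists_boundary {P : NSOperad.{v, w} k} {Q : NSOperad.{v, w'} k}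
    {D : P.Differential} {f : DGHom D (Differential.zero Q)} (hf : f.IsQuasiIso)
    {m : ℕ} {i : ℤ} {t : P.obj m i} (ht : ∀ {j : ℤ} (h : j + 1 = i), D.d h t = 0)
    (ht' : f.map t = 0) : ∃ u : P.obj m (i + 1), D.d rfl u = t := by
  have h := (hf m i).1 (a₁ := Submodule.Quotient.mk ⟨t, ht _⟩) (a₂ := 0) (by
    rw [map_zero]
    refine (Submodule.Quotient.mk_eq_zero _).2 ?_
    have h0 : f.cyclesMap m i ⟨t, ht _⟩ = 0 := Subtype.ext ht'
    rw [h0]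
    exact Submodule.zero_mem _)
  exact (Submodule.Quotient.mk_eq_zero _).1 h

/-- A quasi-isomorphism to an operad with zero differential is surjective. -/
theorem DGHom.IsQuasiIso.exists_map_eq {P : NSOperad.{v, w} k} {Q : NSOperad.{v, w'} k}
    {D : P.Differential} {f : DGHom D (Differential.zero Q)} (hf : f.IsQuasiIso)
    {m : ℕ} {i : ℤ} (z : Q.obj m i) :
    ∃ t : P.obj m i, f.map t = z := by
  obtain ⟨c, hc⟩ := (hf m i).2 (Submodule.Quotient.mk ⟨z, rfl⟩)
  obtain ⟨t, rfl⟩ := Submodule.Quotient.mk_surjective _ c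
  have h := (Submodule.Quotient.eq _).1 hc
  obtain ⟨y, hy⟩ := h
  have hy' : (0 : Q.obj m i) = f.map t.1 - z := hy
  exact ⟨t, sub_eq_zero.1 hy'.symm⟩

end NSOperad

/-! ### Consequences of minimality. -/

namespace MinimalModel

open FreeOperad

variable {k : Type v} [Field k] {P : NSOperad.{v, w} k} (M : MinimalModel.{w', v, w} P)

/-- Generators have decomposable boundary, and the differential preserves arity, so by the Leibniz
rule it sends products to products. -/
theorem diff_mem_products {m : ℕ} {i j : ℤ} (h : j + 1 = i)
    (t : (freeOperad k M.E).obj m i) (hm : m ≠ 1) : M.diff.d h t ∈ products k M.E m j := by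
  obtain ⟨e, δ, hδ, rfl⟩ := exists_gen_add M.eq_zero hm t
  rw [map_add]
  refine Submodule.add_mem _ (decomposables_le_products M.eq_zero hm (M.decomposable h e)) ?_
  have hle : products k M.E m i ≤ (products k M.E m j).comap (M.diff.d h) :=
    products_le fun {m n i₁ i₂} a ha hl hp x y hm hn => by
      rw [Submodule.mem_comap, M.diff.leibniz a ha hl hp (sub_add_cancel i₁ 1)
        (sub_add_cancel i₂ 1) h (by omega) (by omega)]
      exact Submodule.add_mem _ (comp_mem_products _ _ _ _ _ _ hm hn)
        (Submodule.smul_mem _ _ (comp_mem_products _ _ _ _ _ _ hm hn))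
  exact hle hδ

/-- By minimality, a generator that agrees with products both in the differential and in the image
in the operad vanishes. -/
theorem eq_zero_of_products {m : ℕ} {i : ℤ} {e : M.E m i} {δ : (freeOperad k M.E).obj m i}
    (hδ : δ ∈ products k M.E m i)
    (hd : ∀ {j : ℤ} (h : j + 1 = i), M.diff.d h δ = M.diff.d h (gen k M.E e))
    (hp : M.proj.map δ = M.proj.map (gen k M.E e)) : e = 0 := by
  by_cases hm : m < 2
  · have := M.eq_zero m i hm
    exact Subsingleton.elim _ _
  -- The difference is a cycle killed by `ρ`, so it is a boundary and thereby a sum of products.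
  obtain ⟨u, hu⟩ := M.quasiIso.exists_boundary (t := gen k M.E e - δ)
    (fun h => by rw [map_sub, hd h, sub_self]) (by rw [map_sub, hp, sub_self])
  have hu' := M.diff_mem_products rfl u (by omega)
  rw [hu] at hu'
  exact eq_zero_of_gen_mem_products ((Submodule.sub_mem_iff_left _ hδ).1 hu')

end MinimalModel

/-! ### Weight equals arity in the quadratic operad. -/

namespace quadraticOperad

open FreeOperad

variable {k : Type v} [Field k] {c : ℕ} {d : ℤ}
    {X : ℕ → ℤ → Type u} [∀ m i, AddCommGroup (X m i)] [∀ m i, Module k (X m i)]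

theorem subsingleton_of_lt_two {X : ℕ → ℤ → Type u} (hc : 0 < c)
    (hX : ∀ (m : ℕ) (i : ℤ), ¬ (m = 1 * c + 1 ∧ i = d) → Subsingleton (X m i))
    (m : ℕ) (i : ℤ) (hm : m < 2) : Subsingleton (X m i) :=
  hX m i (by omega)

theorem generatorWeight_eq_bot
    (hX : ∀ (m : ℕ) (i : ℤ), ¬ (m = 1 * c + 1 ∧ i = d) → Subsingleton (X m i))
    (p m : ℕ) (i : ℤ) (h : m ≠ p * c + 1) :
    (if p = 1 then (⊤ : Submodule k (X m i)) else ⊥) = ⊥ := by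
  split_ifs with hp
  · subst hp
    have := hX m i (by omega)
    exact Subsingleton.elim _ _
  · rfl

theorem iSup_generatorWeight (m : ℕ) (i : ℤ) :
    ⨆ p : ℕ, (if p = 1 then (⊤ : Submodule k (X m i)) else ⊥) = ⊤ :=
  eq_top_iff.2 (le_iSup_of_le 1 (by rw [if_pos rfl]))

theorem vertexPart_eq_bot (hc : 0 < c)
    (hX : ∀ (m : ℕ) (i : ℤ), ¬ (m = 1 * c + 1 ∧ i = d) → Subsingleton (X m i))
    {p m : ℕ} (i : ℤ) (h : m ≠ p * c + 1) : vertexPart k X p m i = ⊥ :=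
  weightPart_eq_bot (subsingleton_of_lt_two hc hX) (N := m + 1)
    (fun p m i _ => generatorWeight_eq_bot hX p m i) i (by omega) h

theorem vertexPart_eq_top (hc : 0 < c)
    (hX : ∀ (m : ℕ) (i : ℤ), ¬ (m = 1 * c + 1 ∧ i = d) → Subsingleton (X m i))
    {p m : ℕ} (i : ℤ) (h : m = p * c + 1) : vertexPart k X p m i = ⊤ :=
  weightPart_eq_top (subsingleton_of_lt_two hc hX) (N := m + 1) hc
    (fun p m i _ => generatorWeight_eq_bot hX p m i) iSup_generatorWeight i (by omega) h

theorem free_eq_zero (hc : 0 < c)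
    (hX : ∀ (m : ℕ) (i : ℤ), ¬ (m = 1 * c + 1 ∧ i = d) → Subsingleton (X m i))
    {m : ℕ} {i : ℤ} (h : ∀ p, m ≠ p * c + 1) (t : (freeOperad k X).obj m i) : t = 0 :=
  eq_zero_of_arity_ne (subsingleton_of_lt_two hc hX) (N := m + 1)
    (fun p m i _ => generatorWeight_eq_bot hX p m i) iSup_generatorWeight (by omega) h t

/-- The projection `T(X) → P(X, R)`. -/
def toQuadratic (R : ∀ m i, Submodule k ((freeOperad k X).obj m i)) :
    (freeOperad k X).Hom (quadraticOperad X R) :=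
  (freeOperad k X).quotientHom _ ((freeOperad k X).idealSpan_isIdeal R)

variable {R : ∀ m i, Submodule k ((freeOperad k X).obj m i)}

theorem toQuadratic_surjective {m : ℕ} {i : ℤ} (z : (quadraticOperad X R).obj m i) :
    ∃ y, (toQuadratic R).map y = z :=
  Submodule.mkQ_surjective _ z

theorem toQuadratic_eq_zero {m : ℕ} {i : ℤ} {y : (freeOperad k X).obj m i} :
    (toQuadratic R).map y = 0 ↔ y ∈ (freeOperad k X).idealSpan R m i :=
  Submodule.Quotient.mk_eq_zero _

end quadraticOperad

/-! ### Existence and uniqueness of the weight grading. -/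

namespace MinimalModel

open FreeOperad quadraticOperad

variable {k : Type v} [Field k] {c : ℕ} {d : ℤ}
    {X : ℕ → ℤ → Type u} [∀ m i, AddCommGroup (X m i)] [∀ m i, Module k (X m i)]
    {R : ∀ m i, Submodule k ((freeOperad k X).obj m i)}
    (M : MinimalModel.{w', v, max u v} (quadraticOperad X R))

/-- The minimal model is concentrated in the arities `p * c + 1`. -/
theorem free_eq_zero (hc : 0 < c)
    (hX : ∀ (m : ℕ) (i : ℤ), ¬ (m = 1 * c + 1 ∧ i = d) → Subsingleton (X m i))
    {m : ℕ} {i : ℤ} (h : ∀ p, m ≠ p * c + 1) (t : (freeOperad k M.E).obj m i) : t = 0 := by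
  induction m using Nat.strong_induction_on generalizing i with
  | _ m ih =>
    obtain rfl | hm0 := Nat.eq_zero_or_pos m
    · exact eq_zero_of_arity_zero M.eq_zero rfl t
    have hm1 : m ≠ 1 := by simpa using h 0
    -- If both factors had arities congruent to one modulo `c` in the required form, so would the
    -- composite; hence one factor vanishes by induction.
    have hprod : ∀ j, products k M.E m j = ⊥ := by
      refine fun j => le_bot_iff.1 (products_le fun {m₁ n₁ _ _} a ha hl hp x y hm hn => ?_)
      rw [Submodule.mem_bot]
      by_cases hp : ∃ p, m₁ = p * c + 1
      · obtain ⟨p, rfl⟩ := hp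
        have hy : y = 0 := ih n₁ (by omega) (fun q hq => h (p + q) (by rw [add_mul]; omega)) y
        rw [hy, map_zero]
      · rw [ih m₁ (by omega) (not_exists.1 hp) x, map_zero, LinearMap.zero_apply]
    obtain ⟨e, δ, hδ, rfl⟩ := exists_gen_add M.eq_zero hm1 t
    rw [hprod, Submodule.mem_bot] at hδ
    have he : e = 0 := by
      refine M.eq_zero_of_products (δ := 0) (Submodule.zero_mem _) (fun {j} hj => ?_) ?_
      · have h' := M.diff_mem_products hj (gen k M.E e) hm1
        rw [hprod, Submodule.mem_bot] at h'
        rw [h', map_zero]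
      · obtain ⟨y, hy⟩ := toQuadratic_surjective (M.proj.map (gen k M.E e))
        rw [← hy, quadraticOperad.free_eq_zero hc hX h y, map_zero, map_zero]
    rw [he, hδ, map_zero, add_zero]

theorem subsingleton_E (hc : 0 < c)
    (hX : ∀ (m : ℕ) (i : ℤ), ¬ (m = 1 * c + 1 ∧ i = d) → Subsingleton (X m i))
    {m : ℕ} (i : ℤ) (h : ∀ p, m ≠ p * c + 1) : Subsingleton (M.E m i) := by
  refine subsingleton_of_forall_eq 0 fun e => eq_zero_of_gen_mem_products (k := k) ?_
  rw [M.free_eq_zero hc hX h (gen k M.E e)]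
  exact Submodule.zero_mem _

/-- The weight grading of the generators by arity. -/
def arityWeight (c : ℕ) (p m : ℕ) (i : ℤ) : Submodule k (M.E m i) :=
  if m = p * c + 1 then ⊤ else ⊥

theorem iSup_arityWeight (hc : 0 < c)
    (hX : ∀ (m : ℕ) (i : ℤ), ¬ (m = 1 * c + 1 ∧ i = d) → Subsingleton (X m i)) (m : ℕ) (i : ℤ) :
    ⨆ p, M.arityWeight c p m i = ⊤ := by
  by_cases h : ∃ p, m = p * c + 1
  · obtain ⟨p, hp⟩ := h
    exact eq_top_iff.2 (le_iSup_of_le p (by rw [arityWeight, if_pos hp]))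
  · have := M.subsingleton_E hc hX i (not_exists.1 h)
    exact Subsingleton.elim _ _

/-- The part of weight `p` is everything in arity `p * c + 1` and zero elsewhere, and `∂` and `ρ`
preserve arity. -/
theorem isWeightGrading_arityWeight (hc : 0 < c)
    (hX : ∀ (m : ℕ) (i : ℤ), ¬ (m = 1 * c + 1 ∧ i = d) → Subsingleton (X m i)) :
    M.IsWeightGrading (M.arityWeight c) := by
  have hbot : ∀ p m i, m ≠ p * c + 1 → M.arityWeight c p m i = ⊥ := fun p m i h => if_neg h
  have hsup := M.iSup_arityWeight hc hX
  have hzero : ∀ {p m : ℕ} {i : ℤ} (t : (freeOperad k M.E).obj m i),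
      t ∈ FreeOperad.weightPart (M.arityWeight c) p m i → m ≠ p * c + 1 → t = 0 := by
    intro p m i t ht h
    rwa [weightPart_eq_bot M.eq_zero (N := m + 1) (fun p m i _ => hbot p m i) i (by omega) h,
      Submodule.mem_bot] at ht
  refine ⟨fun m i => ?_, ?_, ?_⟩
  · refine (DirectSum.isInternal_submodule_iff_iSupIndep_and_iSup_eq_top _).2 ⟨?_, hsup m i⟩
    intro p
    by_cases h : m = p * c + 1
    · have h0 : ⨆ (q : ℕ) (_ : q ≠ p), M.arityWeight c q m i = ⊥ := by
        refine le_bot_iff.1 (iSup₂_le fun q hq => ?_)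
        rw [hbot q m i fun h' => hq (Nat.eq_of_mul_eq_mul_right hc (by omega))]
      rw [h0]
      exact disjoint_bot_right
    · change Disjoint (M.arityWeight c p m i) _
      rw [hbot p m i h]
      exact disjoint_bot_left
  · intro p m i j h t ht
    by_cases hm : m = p * c + 1
    · rw [weightPart_eq_top M.eq_zero (N := m + 1) hc (fun p m i _ => hbot p m i) hsup j
        (by omega) hm]
      trivial
    · rw [hzero t ht hm, map_zero]
      exact Submodule.zero_mem _
  · intro p m i t ht
    by_cases hm : m = p * c + 1
    · rw [quadraticOperad.weightPart, vertexPart_eq_top hc hX i hm]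
      obtain ⟨y, hy⟩ := toQuadratic_surjective (M.proj.map t)
      exact ⟨y, trivial, hy⟩
    · rw [hzero t ht hm, map_zero]
      exact Submodule.zero_mem _

/-- In every weight grading the weight of a generator is determined by its arity. -/
theorem IsWeightGrading.eq_bot [CharZero k]
    {M : MinimalModel.{w', v, max u v} (quadraticOperad X R)} {W : ℕ → ∀ m i, Submodule k (M.E m i)}
    (hW : M.IsWeightGrading W) (hc : 0 < c)
    (hX : ∀ (m : ℕ) (i : ℤ), ¬ (m = 1 * c + 1 ∧ i = d) → Subsingleton (X m i))
    {p m : ℕ} (i : ℤ) (h : m ≠ p * c + 1) : W p m i = ⊥ := by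
  have hsup : ∀ m i, ⨆ p, W p m i = ⊤ := fun m i => (hW.isInternal m i).submodule_iSup_eq_top
  induction m using Nat.strong_induction_on generalizing p i with
  | _ m ih =>
    by_cases hq : ∃ q, m = q * c + 1
    swap
    · have := M.subsingleton_E hc hX i (not_exists.1 hq)
      exact Subsingleton.elim _ _
    obtain ⟨q, rfl⟩ := hq
    by_cases hm1 : q * c + 1 < 2
    · have := M.eq_zero _ i hm1
      exact Subsingleton.elim _ _
    -- Both factors have smaller arity, so by induction their weights are dictated by their arities,
    -- and the product has weight `q`.
    have hprod : ∀ j, products k M.E (q * c + 1) j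
        ≤ FreeOperad.weightPart W q (q * c + 1) j := by
      refine fun j => products_le_of_arity (M.free_eq_zero hc hX)
        fun {p' q'} _ _ a ha hl hf x y hp hq hpq => ?_
      subst hpq
      have hbot : ∀ r m i, m < (p' + q') * c + 1 → m ≠ r * c + 1 → W r m i = ⊥ :=
        fun r m i hm h => ih m hm i h
      have hpq := add_mul p' q' c
      have hp1 := Nat.mul_le_mul_right c hp
      have hq1 := Nat.mul_le_mul_right c hq
      refine comp_mem_weightPart a ha hl hf ?_ ?_
      · rw [weightPart_eq_top M.eq_zero (N := (p' + q') * c + 1) hc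
          hbot hsup _ (by omega) rfl]
        trivial
      · rw [weightPart_eq_top M.eq_zero (N := (p' + q') * c + 1) hc
          hbot hsup _ (by omega) rfl]
        trivial
    refine (Submodule.eq_bot_iff _).2 fun e he => ?_
    have he' : gen k M.E e ∈ FreeOperad.weightPart W p (q * c + 1) i :=
      Submodule.subset_span (IsMonomial.gen e he)
    -- The boundary has weight `p` since `e` does and weight `q` as a product, so it is zero; the
    -- image under `ρ` lies in weight `p` of `P`, which is zero in this arity.
    refine M.eq_zero_of_products (δ := 0) (Submodule.zero_mem _) (fun {j} hj => ?_) ?_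
    · rw [map_zero, eq_zero_of_mem_weightPart hW.isInternal (p := p) (q := q)
        (by rintro rfl; exact h rfl) (hW.diff_mem hj _ he')
        (hprod j (M.diff_mem_products hj _ (by omega)))]
    · have h' := hW.proj_mem _ he'
      rw [quadraticOperad.weightPart, vertexPart_eq_bot hc hX i h] at h'
      obtain ⟨y, hy, hy'⟩ := h'
      obtain rfl := (Submodule.mem_bot k).1 hy
      exact (map_zero _).trans ((map_zero (toQuadratic R).map).symm.trans hy')

end MinimalModel

/-! ### Lifting `T(X)` to the minimal model, and degrees in low weight. -/

namespace MinimalModel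

open FreeOperad quadraticOperad

variable {k : Type v} [Field k] {c : ℕ} {d : ℤ}
    {X : ℕ → ℤ → Type u} [∀ m i, AddCommGroup (X m i)] [∀ m i, Module k (X m i)]
    {R : ∀ m i, Submodule k ((freeOperad k X).obj m i)}
    (M : MinimalModel.{w', v, max u v} (quadraticOperad X R))

theorem exists_gen_of_arity (hc : 0 < c)
    (hX : ∀ (m : ℕ) (i : ℤ), ¬ (m = 1 * c + 1 ∧ i = d) → Subsingleton (X m i))
    {i : ℤ} (t : (freeOperad k M.E).obj (1 * c + 1) i) : ∃ e, t = gen k M.E e := by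
  obtain ⟨e, δ, hδ, rfl⟩ := exists_gen_add M.eq_zero (by omega) t
  rw [products_one_mul_eq_bot (M.free_eq_zero hc hX), Submodule.mem_bot] at hδ
  exact ⟨e, by rw [hδ, add_zero]⟩

theorem diff_eq_zero_of_arity (hc : 0 < c)
    (hX : ∀ (m : ℕ) (i : ℤ), ¬ (m = 1 * c + 1 ∧ i = d) → Subsingleton (X m i))
    {i j : ℤ} (h : j + 1 = i) (t : (freeOperad k M.E).obj (1 * c + 1) i) :
    M.diff.d h t = 0 := by
  have h' := M.diff_mem_products h t (by omega)
  rwa [products_one_mul_eq_bot (M.free_eq_zero hc hX), Submodule.mem_bot] at h'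

/-- Arity one contains only multiples of the identity, which sit in degree zero. -/
theorem diff_one {j : ℤ} (h : j + 1 = 0) : M.diff.d h (freeOperad k M.E).one = 0 := by
  have h' := mem_span_isOne M.eq_zero (M.diff.d h (freeOperad k M.E).one)
  have h0 : Submodule.span k {t : (freeOperad k M.E).obj 1 j | IsOne k M.E t} = ⊥ := by
    refine Submodule.span_eq_bot.2 fun x hx => ?_
    cases hx
    omega
  rwa [h0, Submodule.mem_bot] at h'

/-- The projection `T(X) → P(X, R)` lifts to a morphism from `T(X)` to the minimal model whose
image consists of cycles. -/
theorem exists_lift (hc : 0 < c)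
    (hX : ∀ (m : ℕ) (i : ℤ), ¬ (m = 1 * c + 1 ∧ i = d) → Subsingleton (X m i)) :
    ∃ φ : (freeOperad k X).Hom (freeOperad k M.E),
      (∀ {m : ℕ} {i : ℤ} (y : (freeOperad k X).obj m i),
        M.proj.map (φ.map y) = (toQuadratic R).map y) ∧
      ∀ {m : ℕ} {i j : ℤ} (h : j + 1 = i) (y : (freeOperad k X).obj m i),
        M.diff.d h (φ.map y) = 0 := by
  have hs : ∀ (m : ℕ) (i : ℤ), ∃ s : X m i →ₗ[k] M.E m i,
      ∀ x, M.proj.map (gen k M.E (s x)) = (toQuadratic R).map (gen k X x) := by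
    intro m i
    -- Since `ρ` is onto and in arity `c + 1` all of `T(E)` consists of generators, `f` reaches the
    -- images of the elements of `X`; over a field these choices can be made linearly.
    let f : M.E m i →ₗ[k] (quadraticOperad X R).obj m i := M.proj.map ∘ₗ gen k M.E
    let g : X m i →ₗ[k] (quadraticOperad X R).obj m i := (toQuadratic R).map ∘ₗ gen k X
    have hfg : ∀ x, g x ∈ LinearMap.range f := by
      intro x
      by_cases h : m = 1 * c + 1 ∧ i = d
      · obtain ⟨rfl, rfl⟩ := h
        obtain ⟨t, ht⟩ := M.quasiIso.exists_map_eq (g x)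
        obtain ⟨e, rfl⟩ := M.exists_gen_of_arity hc hX t
        exact ⟨e, ht⟩
      · have := hX m i h
        rw [Subsingleton.elim x 0, map_zero]
        exact Submodule.zero_mem _
    obtain ⟨s, hs⟩ := Module.projective_lifting_property f.rangeRestrict (g.codRestrict _ hfg)
      f.surjective_rangeRestrict
    exact ⟨s, fun x => congrArg Subtype.val (LinearMap.congr_fun hs x)⟩
  choose s hs using hs
  let φ : (freeOperad k X).Hom (freeOperad k M.E) :=
    lift (freeOperad k M.E) fun {m i} => gen k M.E ∘ₗ s m i
  refine ⟨φ, fun y => ?_, fun {m i j} h y => ?_⟩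
  · exact hom_ext (f := M.proj.toHom.comp φ) (g := toQuadratic R) (fun e => hs _ _ e) y
  · let S : ∀ m i, Submodule k ((freeOperad k X).obj m i) := fun m i =>
      ⨅ (j : ℤ) (h : j + 1 = i), LinearMap.ker (M.diff.d h ∘ₗ φ.map)
    have key : y ∈ S m i := by
      refine mem_of_closed S ?_ ?_ ?_ y
      · simp only [S, Submodule.mem_iInf]
        intro j h
        exact (congrArg (M.diff.d h) φ.map_one).trans (M.diff_one h)
      · intro m i x
        simp only [S, Submodule.mem_iInf]
        intro j h
        by_cases h' : m = 1 * c + 1 ∧ i = d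
        · obtain ⟨rfl, rfl⟩ := h'
          exact M.diff_eq_zero_of_arity hc hX h _
        · have := hX m i h'
          rw [Subsingleton.elim x 0, map_zero]
          exact Submodule.zero_mem _
      · intro m n l i j p a ha hl hp x y hx hy
        simp only [S, Submodule.mem_iInf, LinearMap.mem_ker, LinearMap.comp_apply] at hx hy ⊢
        intro p' h
        rw [φ.map_comp, M.diff.leibniz a ha hl hp (sub_add_cancel i 1) (sub_add_cancel j 1) h
          (by omega) (by omega), hx _ (sub_add_cancel i 1), hy _ (sub_add_cancel j 1)]
        simp
    simp only [S, Submodule.mem_iInf] at key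
    exact key j h

/-- A generator of arity other than that of `X` vanishes if its differential is the differential
of products. -/
theorem eq_zero_of_diff_eq (hc : 0 < c)
    (hX : ∀ (m : ℕ) (i : ℤ), ¬ (m = 1 * c + 1 ∧ i = d) → Subsingleton (X m i))
    {m : ℕ} {i : ℤ} (hm : m ≠ 1 * c + 1) {e : M.E m i} {δ : (freeOperad k M.E).obj m i}
    (hδ : δ ∈ products k M.E m i)
    (hd : ∀ {j : ℤ} (h : j + 1 = i), M.diff.d h δ = M.diff.d h (gen k M.E e)) : e = 0 := by
  by_cases hm2 : m < 2
  · have := M.eq_zero m i hm2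
    exact Subsingleton.elim _ _
  obtain ⟨φ, hφ, hφd⟩ := M.exists_lift hc hX
  obtain ⟨y, hy⟩ := toQuadratic_surjective (M.proj.map (gen k M.E e - δ))
  have hy' : y ∈ products k X m i := by
    obtain ⟨x, y, hy, rfl⟩ := exists_gen_add (subsingleton_of_lt_two hc hX) (by omega) y
    have := hX m i (fun h => hm h.1)
    rwa [Subsingleton.elim x 0, map_zero, zero_add]
  -- Adding the cycle `φ.map y` to `δ` corrects its image under `ρ` without changing its boundary;
  -- it is a sum of products because `X` is zero in this arity.
  refine M.eq_zero_of_products (δ := δ + φ.map y)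
    (Submodule.add_mem _ hδ (map_mem_products φ hy')) (fun h => ?_) ?_
  · rw [map_add, hφd, add_zero, hd]
  · rw [map_add, hφ, hy, map_sub, add_sub_cancel]

/-- There are no products in this arity: the differential vanishes, and `P` is a quotient of `X`,
which lives in degree `d`. -/
theorem generator_eq_zero_of_weight_one (hc : 0 < c)
    (hX : ∀ (m : ℕ) (i : ℤ), ¬ (m = 1 * c + 1 ∧ i = d) → Subsingleton (X m i))
    {i : ℤ} (hi : i ≠ d) (e : M.E (1 * c + 1) i) : e = 0 := by
  refine M.eq_zero_of_products (δ := 0) (Submodule.zero_mem _) (fun h => ?_) ?_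
  · rw [map_zero, M.diff_eq_zero_of_arity hc hX]
  · obtain ⟨y, hy⟩ := toQuadratic_surjective (M.proj.map (gen k M.E e))
    obtain ⟨x, δ, hδ, rfl⟩ := exists_gen_add (subsingleton_of_lt_two hc hX) (by omega) y
    rw [products_one_mul_eq_bot (quadraticOperad.free_eq_zero hc hX), Submodule.mem_bot] at hδ
    have := hX (1 * c + 1) i (fun h => hi h.2)
    rw [← hy, hδ, Subsingleton.elim x 0, map_zero, map_zero, add_zero, map_zero]

/-- The operations of arity `c + 1` in the minimal model have degree `d`. -/
theorem eq_zero_of_weight_one (hc : 0 < c)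
    (hX : ∀ (m : ℕ) (i : ℤ), ¬ (m = 1 * c + 1 ∧ i = d) → Subsingleton (X m i))
    {i : ℤ} (hi : i ≠ d) (t : (freeOperad k M.E).obj (1 * c + 1) i) : t = 0 := by
  obtain ⟨e, rfl⟩ := M.exists_gen_of_arity hc hX t
  rw [M.generator_eq_zero_of_weight_one hc hX hi e, map_zero]

theorem products_weight_two_eq_bot (hc : 0 < c)
    (hX : ∀ (m : ℕ) (i : ℤ), ¬ (m = 1 * c + 1 ∧ i = d) → Subsingleton (X m i))
    {i : ℤ} (hi : i ≠ 2 * d) : products k M.E (2 * c + 1) i = ⊥ := by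
  refine le_bot_iff.1 (products_le_of_arity (M.free_eq_zero hc hX)
    fun {p q i j} a ha hl hf x y hp hq hpq => ?_)
  obtain rfl : p = 1 := by omega
  obtain rfl : q = 1 := by omega
  rw [Submodule.mem_bot]
  by_cases h : i = d
  · rw [M.eq_zero_of_weight_one hc hX (by omega) y, map_zero]
  · rw [M.eq_zero_of_weight_one hc hX h x, map_zero, LinearMap.zero_apply]

theorem generator_eq_zero_of_weight_two (hc : 0 < c)
    (hX : ∀ (m : ℕ) (i : ℤ), ¬ (m = 1 * c + 1 ∧ i = d) → Subsingleton (X m i))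
    {i : ℤ} (hi : i ≠ 2 * d + 1) (e : M.E (2 * c + 1) i) : e = 0 := by
  refine M.eq_zero_of_diff_eq hc hX (δ := 0) (by omega) (Submodule.zero_mem _) fun {j} h => ?_
  have h' := M.diff_mem_products h (gen k M.E e) (by omega)
  rw [M.products_weight_two_eq_bot hc hX (by omega), Submodule.mem_bot] at h'
  rw [h', map_zero]

theorem eq_zero_of_weight_two (hc : 0 < c)
    (hX : ∀ (m : ℕ) (i : ℤ), ¬ (m = 1 * c + 1 ∧ i = d) → Subsingleton (X m i))
    {i : ℤ} (hi : i ≠ 2 * d) (hi' : i ≠ 2 * d + 1)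
    (t : (freeOperad k M.E).obj (2 * c + 1) i) : t = 0 := by
  obtain ⟨e, δ, hδ, rfl⟩ := exists_gen_add M.eq_zero (by omega) t
  rw [M.products_weight_two_eq_bot hc hX hi, Submodule.mem_bot] at hδ
  rw [M.generator_eq_zero_of_weight_two hc hX hi' e, hδ, map_zero, add_zero]

/-- One factor has weight one and degree `d`, the other has weight two and degree `2 * d` or `2 * d
+ 1`. -/
theorem products_weight_three_eq_bot (hc : 0 < c)
    (hX : ∀ (m : ℕ) (i : ℤ), ¬ (m = 1 * c + 1 ∧ i = d) → Subsingleton (X m i))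
    {i : ℤ} (hi : i ≠ 3 * d) (hi' : i ≠ 3 * d + 1) : products k M.E (3 * c + 1) i = ⊥ := by
  refine le_bot_iff.1 (products_le_of_arity (M.free_eq_zero hc hX)
    fun {p q i j} a ha hl hf x y hp hq hpq => ?_)
  rw [Submodule.mem_bot]
  obtain ⟨rfl, rfl⟩ | ⟨rfl, rfl⟩ : p = 1 ∧ q = 2 ∨ p = 2 ∧ q = 1 := by omega
  · by_cases h : i = d
    · rw [M.eq_zero_of_weight_two hc hX (by omega) (by omega) y, map_zero]
    · rw [M.eq_zero_of_weight_one hc hX h x, map_zero, LinearMap.zero_apply]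
  · by_cases h : j = d
    · rw [M.eq_zero_of_weight_two hc hX (by omega) (by omega) x, map_zero, LinearMap.zero_apply]
    · rw [M.eq_zero_of_weight_one hc hX h y, map_zero]

/-! ### Boundaries over the ideal of relations. -/

section Lift

variable {M} {φ : (freeOperad k X).Hom (freeOperad k M.E)}

/-- After correcting `t` by a lift of its image in `P`, what remains is a generator that is a cycle
killed by `ρ`, hence zero. -/
theorem lift_surjective_weight_one (hc : 0 < c)
    (hX : ∀ (m : ℕ) (i : ℤ), ¬ (m = 1 * c + 1 ∧ i = d) → Subsingleton (X m i))
    (hφ : ∀ {m : ℕ} {i : ℤ} (y : (freeOperad k X).obj m i),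
        M.proj.map (φ.map y) = (toQuadratic R).map y)
    {i : ℤ} (t : (freeOperad k M.E).obj (1 * c + 1) i) : ∃ y, φ.map y = t := by
  obtain ⟨y, hy⟩ := toQuadratic_surjective (M.proj.map t)
  obtain ⟨e, he⟩ := M.exists_gen_of_arity hc hX (t - φ.map y)
  have he0 : e = 0 := by
    refine M.eq_zero_of_products (δ := 0) (Submodule.zero_mem _) (fun h => ?_) ?_
    · rw [map_zero, M.diff_eq_zero_of_arity hc hX]
    · rw [← he, map_sub, hφ, hy, sub_self, map_zero]
  rw [he0, map_zero, sub_eq_zero] at he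
  exact ⟨y, he.symm⟩

theorem lift_surjective_weight_two (hc : 0 < c)
    (hX : ∀ (m : ℕ) (i : ℤ), ¬ (m = 1 * c + 1 ∧ i = d) → Subsingleton (X m i))
    (hφ : ∀ {m : ℕ} {i : ℤ} (y : (freeOperad k X).obj m i),
        M.proj.map (φ.map y) = (toQuadratic R).map y)
    {i : ℤ} (hi : i ≠ 2 * d + 1) (t : (freeOperad k M.E).obj (2 * c + 1) i) :
    ∃ y, φ.map y = t := by
  obtain ⟨e, δ, hδ, rfl⟩ := exists_gen_add M.eq_zero (by omega) t
  rw [M.generator_eq_zero_of_weight_two hc hX hi e, map_zero, zero_add]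
  have h : products k M.E (2 * c + 1) i ≤ LinearMap.range φ.map := by
    refine products_le_of_arity (M.free_eq_zero hc hX)
      fun {p q i j} a ha hl hf x y hp hq hpq => ?_
    obtain rfl : p = 1 := by omega
    obtain rfl : q = 1 := by omega
    obtain ⟨x, rfl⟩ := lift_surjective_weight_one hc hX hφ x
    obtain ⟨y, rfl⟩ := lift_surjective_weight_one hc hX hφ y
    exact ⟨_, φ.map_comp a ha hl hf x y⟩
  exact h hδ

/-- Total degree `3 * d` forces the factor of weight two into degree `2 * d`, where there are no new
generators. -/
theorem products_weight_three_le_range (hc : 0 < c)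
    (hX : ∀ (m : ℕ) (i : ℤ), ¬ (m = 1 * c + 1 ∧ i = d) → Subsingleton (X m i))
    (hφ : ∀ {m : ℕ} {i : ℤ} (y : (freeOperad k X).obj m i),
        M.proj.map (φ.map y) = (toQuadratic R).map y) :
    products k M.E (3 * c + 1) (3 * d) ≤ LinearMap.range φ.map := by
  refine products_le_of_arity (M.free_eq_zero hc hX)
    fun {p q i j} a ha hl hf x y hp hq hpq => ?_
  obtain ⟨rfl, rfl⟩ | ⟨rfl, rfl⟩ : p = 1 ∧ q = 2 ∨ p = 2 ∧ q = 1 := by omega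
  · by_cases h : i = d
    · obtain ⟨x, rfl⟩ := lift_surjective_weight_one hc hX hφ x
      obtain ⟨y, rfl⟩ := lift_surjective_weight_two hc hX hφ (by omega) y
      exact ⟨_, φ.map_comp a ha hl hf x y⟩
    · rw [M.eq_zero_of_weight_one hc hX h x, map_zero, LinearMap.zero_apply]
      exact Submodule.zero_mem _
  · by_cases h : j = d
    · obtain ⟨x, rfl⟩ := lift_surjective_weight_two hc hX hφ (by omega) x
      obtain ⟨y, rfl⟩ := lift_surjective_weight_one hc hX hφ y
      exact ⟨_, φ.map_comp a ha hl hf x y⟩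
    · rw [M.eq_zero_of_weight_one hc hX h y, map_zero]
      exact Submodule.zero_mem _

/-- Every element of the ideal of relations lifts to the boundary of an operation that is a sum of
products, unless its arity is `2 * c + 1`. -/
theorem exists_boundary_of_mem_idealSpan (hc : 0 < c)
    (hX : ∀ (m : ℕ) (i : ℤ), ¬ (m = 1 * c + 1 ∧ i = d) → Subsingleton (X m i))
    (hR : ∀ (m : ℕ) (i : ℤ), R m i ≤ FreeOperad.vertexPart k X 2 m i)
    (hφ : ∀ {m : ℕ} {i : ℤ} (y : (freeOperad k X).obj m i),
        M.proj.map (φ.map y) = (toQuadratic R).map y)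
    (hφd : ∀ {m : ℕ} {i j : ℤ} (h : j + 1 = i) (y : (freeOperad k X).obj m i),
        M.diff.d h (φ.map y) = 0)
    {m : ℕ} {i : ℤ} {y : (freeOperad k X).obj m i}
    (hy : y ∈ (freeOperad k X).idealSpan R m i) :
    ∃ t ∈ productsOrArity k M.E (2 * c + 1) m (i + 1), M.diff.d rfl t = φ.map y := by
  -- It suffices that this family is an ideal containing `R`. An operation bounding a relation in
  -- arity `2 * c + 1` may involve generators, so everything is allowed there; any further
  -- composition with arity at least two yields products.
  let I : ∀ m i, Submodule k ((freeOperad k X).obj m i) := fun m i =>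
    ((productsOrArity k M.E (2 * c + 1) m (i + 1)).map (M.diff.d rfl)).comap φ.map
  have hI : (freeOperad k X).IsIdeal I := by
    constructor
    · rintro m n l i j p a ha hl rfl x y ⟨t, ht, htx⟩
      refine ⟨(freeOperad k M.E).comp a ha hl (add_right_comm i 1 j) t (φ.map y),
        comp_mem_productsOrArity_left M.eq_zero (by omega) a ha hl _ ht _, ?_⟩
      rw [M.diff.leibniz a ha hl _ rfl (sub_add_cancel j 1) rfl rfl (by omega), htx, hφd,
        φ.map_comp, map_zero, smul_zero, add_zero]
    · rintro m n l i j p a ha hl rfl x y ⟨t, ht, hty⟩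
      -- The scalar cancels the sign in the Leibniz rule.
      refine ⟨(-1 : k) ^ i • (freeOperad k M.E).comp a ha hl (add_assoc i j 1).symm (φ.map x) t,
        Submodule.smul_mem _ _
          (comp_mem_productsOrArity_right M.eq_zero (by omega) a ha hl _ _ ht), ?_⟩
      rw [map_smul, M.diff.leibniz a ha hl _ (sub_add_cancel i 1) rfl rfl (by omega) rfl, hty,
        hφd, φ.map_comp, map_zero, LinearMap.zero_apply, zero_add, smul_smul, ← mul_zpow,
        neg_one_mul, neg_neg, one_zpow, one_smul]
  have hRI : ∀ m i, R m i ≤ I m i := by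
    intro m i r hr
    by_cases hm : m = 2 * c + 1
    · have hr' : M.proj.map (φ.map r) = 0 := by
        rw [hφ, toQuadratic_eq_zero]
        simp only [NSOperad.idealSpan, Submodule.mem_iInf]
        exact fun J _ hJ => hJ m i hr
      obtain ⟨t, ht⟩ := M.quasiIso.exists_boundary (t := φ.map r) (fun h => hφd h r) hr'
      exact ⟨t, by rw [productsOrArity, if_pos hm]; trivial, ht⟩
    · have h0 := hR m i hr
      rw [vertexPart_eq_bot hc hX i hm, Submodule.mem_bot] at h0
      rw [h0]
      exact Submodule.zero_mem _
  simp only [NSOperad.idealSpan, Submodule.mem_iInf] at hy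
  exact hy I hI hRI

end Lift

/-- Only degree `3 * d + 1` needs the relations: there the boundary of `e` comes from the ideal of
relations in `T(X)`. In all other degrees the boundary lies in a zero space of products. -/
theorem generator_eq_zero_of_weight_three (hc : 0 < c)
    (hX : ∀ (m : ℕ) (i : ℤ), ¬ (m = 1 * c + 1 ∧ i = d) → Subsingleton (X m i))
    (hR : ∀ (m : ℕ) (i : ℤ), R m i ≤ FreeOperad.vertexPart k X 2 m i)
    {i : ℤ} (hi : i ≠ 3 * d + 2) (e : M.E (3 * c + 1) i) : e = 0 := by
  by_cases hi' : i = 3 * d + 1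
  · subst hi'
    obtain ⟨φ, hφ, hφd⟩ := M.exists_lift hc hX
    obtain ⟨y, hy⟩ := products_weight_three_le_range hc hX hφ
      (M.diff_mem_products rfl (gen k M.E e) (by omega))
    have hy0 : (toQuadratic R).map y = 0 := by
      rw [← hφ, hy]
      exact M.proj.comm rfl (gen k M.E e)
    obtain ⟨t, ht, hty⟩ :=
      exists_boundary_of_mem_idealSpan hc hX hR hφ hφd (toQuadratic_eq_zero.1 hy0)
    -- Since `3 * c + 1` differs from the exceptional arity `2 * c + 1`, the bounding operation is a
    -- sum of products.
    rw [productsOrArity, if_neg (by omega)] at ht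
    refine M.eq_zero_of_diff_eq hc hX (by omega) ht fun {j} h => ?_
    obtain rfl : j = 3 * d := by omega
    exact hty.trans hy
  · refine M.eq_zero_of_diff_eq hc hX (δ := 0) (by omega) (Submodule.zero_mem _) fun {j} h => ?_
    have h' := M.diff_mem_products h (gen k M.E e) (by omega)
    rw [M.products_weight_three_eq_bot hc hX (by omega) (by omega), Submodule.mem_bot] at h'
    rw [h', map_zero]

end MinimalModel

theorem mainTheorem4 {k : Type v} [Field k] [CharZero k] (n : ℕ) (hn : 2 ≤ n) (d : ℤ)
    (X : ℕ → ℤ → Type u) [∀ m i, AddCommGroup (X m i)] [∀ m i, Module k (X m i)]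
    (hX : ∀ (m : ℕ) (i : ℤ), ¬ (m = n ∧ i = d) → Subsingleton (X m i))
    (R : ∀ m i, Submodule k ((freeOperad k X).obj m i))
    (hR : ∀ (m : ℕ) (i : ℤ), R m i ≤ FreeOperad.vertexPart k X 2 m i)
    (M : MinimalModel.{w', v, max u v} (quadraticOperad X R)) :
    (∃ W : ℕ → ∀ m i, Submodule k (M.E m i), M.IsWeightGrading W) ∧
    ∀ W : ℕ → ∀ m i, Submodule k (M.E m i), M.IsWeightGrading W →
      (∀ (m : ℕ) (i : ℤ), i ≠ d → W 1 m i = ⊥) ∧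
      (∀ (m : ℕ) (i : ℤ), i ≠ 2 * d + 1 → W 2 m i = ⊥) ∧
      (∀ (m : ℕ) (i : ℤ), i ≠ 3 * d + 2 → W 3 m i = ⊥) := by
  -- Writing `n` as `1 * c + 1` makes it the case `p = 1` of the arities `p * c + 1`.
  obtain ⟨c, rfl⟩ : ∃ c, n = 1 * c + 1 := ⟨n - 1, by omega⟩
  have hc : 0 < c := by omega
  refine ⟨⟨_, M.isWeightGrading_arityWeight hc hX⟩, fun W hW => ?_⟩
  refine ⟨fun m i hi => ?_, fun m i hi => ?_, fun m i hi => ?_⟩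
  · by_cases hm : m = 1 * c + 1
    · subst hm
      exact (Submodule.eq_bot_iff _).2 fun e _ =>
        M.generator_eq_zero_of_weight_one hc hX hi e
    · exact hW.eq_bot hc hX i hm
  · by_cases hm : m = 2 * c + 1
    · subst hm
      exact (Submodule.eq_bot_iff _).2 fun e _ =>
        M.generator_eq_zero_of_weight_two hc hX hi e
    · exact hW.eq_bot hc hX i hm
  · by_cases hm : m = 3 * c + 1
    · subst hm
      exact (Submodule.eq_bot_iff _).2 fun e _ =>
        M.generator_eq_zero_of_weight_three hc hX hR hi e
    · exact hW.eq_bot hc hX i hm
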